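/- Let $\phi:[0,\infty)\to[0,\infty)$ be smooth with $\phi>0$ on $(0,\infty)$, $\phi(0)=0$, $\phi'(0)=1$ and $\phi^{(2k)}(0)=0$ for all $k\ge 0$, so that $g=dr^2+\phi(r)^2\,d\theta^2$, in polar coordinates $(r,\theta)$, extends to a smooth Riemannian metric on $\mathbb{R}^2$. Assume that $\phi$ is nondecreasing on $[R,\infty)$ for some $R$. Let $K=-\phi''/\phi$ be the Gaussian curvature of $g$ and let $$\Delta=\frac{\partial^2}{\partial r^2}+\frac{\phi'}{\phi}\frac{\partial}{\partial r}+\frac1{\phi^2}\frac{\partial^2}{\partial\theta^2}$$ be its Laplacian. A function $u:\mathbb{R}^2\to\mathbb{R}$ is called harmonic if it is $C^2$ and $\Delta u=0$ on $\mathbb{R}^2$, and biharmonic if it is $C^4$ and $\Delta^2u=\Delta(\Delta u)=0$ on $\mathbb{R}^2$. (i) If there is an $\epsilon>0$ such that $K\le -r^{2+\epsilon}$ outside a compact subset of $\mathbb{R}^2$, then there exists a bounded biharmonic function on $\mathbb{R}^2$ that is not harmonic. (ii) If there are $\eta>0$ and $\epsilon>0$ such that $$-\eta r^2\le K\le-\frac{1+\epsilon}{r^2\log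 r}$$ outside a compact subset of $\mathbb{R}^2$, then every bounded biharmonic function on $\mathbb{R}^2$ is harmonic. -/

import Mathlib

open scoped ContDiff

noncomputable section

namespace RotSurface

/-- The Euclidean plane `ℝ²`. -/
abbrev Plane : Type := EuclideanSpace ℝ (Fin 2)

/-- The point of the plane with polar coordinates `(r, θ)`. -/
def polarPt (r θ : ℝ) : Plane := !₂[r * Real.cos θ, r * Real.sin θ]

/-- Partial derivative in the first of two coordinates. -/
def pd1 (f : ℝ → ℝ → ℝ) (s t : ℝ) : ℝ := deriv (fun s' => f s' t) s

/-- Partial derivative in the second of two coordinates. -/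
def pd2 (f : ℝ → ℝ → ℝ) (s t : ℝ) : ℝ := deriv (fun t' => f s t') t

/-- The coefficients of a metric `E ds² + 2 F ds dt + G dt²` in local coordinates `(s, t)`
on a surface. -/
structure MetricCoeffs where
  /-- coefficient of `ds²` -/
  E : ℝ → ℝ → ℝ
  /-- half the coefficient of `ds dt` -/
  F : ℝ → ℝ → ℝ
  /-- coefficient of `dt²` -/
  G : ℝ → ℝ → ℝ

/-- The determinant `E G - F²` of the metric. -/
def MetricCoeffs.disc (g : MetricCoeffs) (s t : ℝ) : ℝ := g.E s t * g.G s t - g.F s t ^ 2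

/-- The Laplace–Beltrami operator `(1/√det g) ∂ᵢ (√det g gⁱʲ ∂ⱼ U)` in local coordinates. -/
def MetricCoeffs.laplacian (g : MetricCoeffs) (U : ℝ → ℝ → ℝ) (s t : ℝ) : ℝ :=
  (1 / √(g.disc s t)) *
    (pd1 (fun a b => (g.G a b * pd1 U a b - g.F a b * pd2 U a b) / √(g.disc a b)) s t +
     pd2 (fun a b => (g.E a b * pd2 U a b - g.F a b * pd1 U a b) / √(g.disc a b)) s t)

/-- The Gaussian curvature of a metric in local coordinates (Brioschi's formula). -/
def MetricCoeffs.gaussCurvature (g : MetricCoeffs) (s t : ℝ) : ℝ :=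
  (Matrix.det !![-(1 / 2) * pd2 (pd2 g.E) s t + pd1 (pd2 g.F) s t - (1 / 2) * pd1 (pd1 g.G) s t,
        (1 / 2) * pd1 g.E s t, pd1 g.F s t - (1 / 2) * pd2 g.E s t;
      pd2 g.F s t - (1 / 2) * pd1 g.G s t, g.E s t, g.F s t;
      (1 / 2) * pd2 g.G s t, g.F s t, g.G s t] -
    Matrix.det !![0, (1 / 2) * pd2 g.E s t, (1 / 2) * pd1 g.G s t;
      (1 / 2) * pd2 g.E s t, g.E s t, g.F s t;
      (1 / 2) * pd1 g.G s t, g.F s t, g.G s t]) / g.disc s t ^ 2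

/-- The metric `dr² + φ(r)² dθ²` in polar coordinates `(r, θ)`, `r > 0`. -/
def polarMetric (φ : ℝ → ℝ) : MetricCoeffs where
  E := fun _ _ => 1
  F := fun _ _ => 0
  G := fun r _ => φ r ^ 2

/-- `dr² + φ(r)² dθ²` is a metric on the punctured plane that extends smoothly to the origin:
`φ` is smooth on `[0, ∞)` and positive on `(0, ∞)`, `φ(0) = 0`, `φ'(0) = 1`, and all
derivatives of `φ` of even order vanish at `0`. Only the values of `φ` on `[0, ∞)` matter. -/
structure IsSmoothProfile (φ : ℝ → ℝ) : Prop where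
  smooth : ContDiffOn ℝ ∞ φ (Set.Ici 0)
  pos : ∀ r, 0 < r → 0 < φ r
  map_zero : φ 0 = 0
  deriv_zero : derivWithin φ (Set.Ici 0) 0 = 1
  even_deriv_zero : ∀ k : ℕ, iteratedDerivWithin (2 * k) φ (Set.Ici 0) 0 = 0

/-- The Laplacian of `dr² + φ(r)² dθ²`, acting on functions of the polar coordinates. -/
def lap (φ : ℝ → ℝ) (U : ℝ → ℝ → ℝ) : ℝ → ℝ → ℝ := (polarMetric φ).laplacian U

/-- The Gaussian curvature of `dr² + φ(r)² dθ²` at the point with polar coordinates `(r, θ)`. -/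
def curv (φ : ℝ → ℝ) (r θ : ℝ) : ℝ := (polarMetric φ).gaussCurvature r θ

/-- A function on the plane, written in polar coordinates. -/
def inPolar (u : Plane → ℝ) : ℝ → ℝ → ℝ := fun r θ => u (polarPt r θ)

/-- `u` is harmonic on the plane with the metric `dr² + φ(r)² dθ²`: it is `C²` on the whole plane
and `Δu = 0`. The metric extends smoothly over the origin, so that `Δu` is continuous on the
whole plane and it is enough to require the equation off the origin. -/
def IsHarmonic (φ : ℝ → ℝ) (u : Plane → ℝ) : Prop :=
  ContDiff ℝ 2 u ∧ ∀ r θ : ℝ, 0 < r → lap φ (inPolar u) r θ = 0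

/-- `u` is biharmonic on the plane with the metric `dr² + φ(r)² dθ²`: it is `C⁴` on the whole
plane and `Δ²u = 0`. Again `Δ²u` is continuous on the whole plane, so that it is enough to require
the equation off the origin. -/
def IsBiharmonic (φ : ℝ → ℝ) (u : Plane → ℝ) : Prop :=
  ContDiff ℝ 4 u ∧ ∀ r θ : ℝ, 0 < r → lap φ (lap φ (inPolar u)) r θ = 0

/-- `u` is a bounded function. -/
def IsBoundedFun (u : Plane → ℝ) : Prop := ∃ B : ℝ, ∀ x, |u x| ≤ B

/-- A profile is smooth at each `r > 0`. -/
theorem IsSmoothProfile.contDiffAt {φ : ℝ → ℝ} (h : IsSmoothProfile φ) {r : ℝ} (hr : 0 < r) :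
    ContDiffAt ℝ ∞ φ r :=
  h.smooth.contDiffAt (Ici_mem_nhds hr)

theorem IsSmoothProfile.hasDerivAt {φ : ℝ → ℝ} (h : IsSmoothProfile φ) {r : ℝ} (hr : 0 < r) :
    HasDerivAt φ (deriv φ r) r :=
  ((h.contDiffAt hr).differentiableAt (by simp)).hasDerivAt

theorem IsSmoothProfile.hasDerivAt_deriv {φ : ℝ → ℝ} (h : IsSmoothProfile φ) {r : ℝ}
    (hr : 0 < r) : HasDerivAt (deriv φ) (deriv (deriv φ) r) r :=
  (((h.contDiffAt hr).derivWithin (m := ∞) (by simp)).differentiableAt (by simp)).hasDerivAt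

/-- The Gaussian curvature is `K = -φ''/φ`. -/
theorem curv_eq {φ : ℝ → ℝ} (h : IsSmoothProfile φ) {r : ℝ} (hr : 0 < r) (θ : ℝ) :
    curv φ r θ = -(deriv (deriv φ) r) / φ r := by
  have hφ : φ r ≠ 0 := (h.pos r hr).ne'
  have h1 : ∀ a, 0 < a → deriv (fun s => φ s ^ 2) a = 2 * φ a * deriv φ a := by
    intro a ha
    rw [((h.hasDerivAt ha).fun_pow 2).deriv]
    norm_num
  have h2 : deriv (fun a => deriv (fun s => φ s ^ 2) a) r =
      2 * deriv φ r ^ 2 + 2 * φ r * deriv (deriv φ) r := by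
    have e : (fun a => deriv (fun s => φ s ^ 2) a) =ᶠ[nhds r]
        fun a => 2 * φ a * deriv φ a := by
      filter_upwards [Ioi_mem_nhds hr] with a ha using h1 a ha
    rw [e.deriv_eq, (((h.hasDerivAt hr).const_mul 2).fun_mul (h.hasDerivAt_deriv hr)).deriv]
    ring
  simp only [curv, MetricCoeffs.gaussCurvature, MetricCoeffs.disc, polarMetric, pd1, pd2,
    Matrix.det_fin_three, deriv_const, h2, h1 r hr]
  simp
  field_simp
  ring

/-- The Laplacian is `Δ = ∂²/∂r² + (φ'/φ) ∂/∂r + (1/φ²) ∂²/∂θ²`. -/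
theorem lap_eq {φ : ℝ → ℝ} (h : IsSmoothProfile φ) {U : ℝ → ℝ → ℝ} {r : ℝ} (hr : 0 < r) (θ : ℝ)
    (hU : DifferentiableAt ℝ (fun s => pd1 U s θ) r) :
    lap φ U r θ = pd1 (pd1 U) r θ + deriv φ r / φ r * pd1 U r θ +
      1 / φ r ^ 2 * pd2 (pd2 U) r θ := by
  have hφ : φ r ≠ 0 := (h.pos r hr).ne'
  have hs : ∀ a, 0 < a → √(φ a ^ 2) = φ a := fun a ha => Real.sqrt_sq (h.pos a ha).le
  have h1 : deriv (fun a => φ a ^ 2 * pd1 U a θ / √(φ a ^ 2)) r =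
      deriv φ r * pd1 U r θ + φ r * deriv (fun s => pd1 U s θ) r := by
    have e : (fun a => φ a ^ 2 * pd1 U a θ / √(φ a ^ 2)) =ᶠ[nhds r]
        fun a => φ a * pd1 U a θ := by
      filter_upwards [Ioi_mem_nhds hr] with a ha
      have : φ a ≠ 0 := (h.pos a ha).ne'
      rw [hs a ha]
      field_simp
    rw [e.deriv_eq, ((h.hasDerivAt hr).fun_mul hU.hasDerivAt).deriv]
  have h2 : lap φ U r θ = 1 / φ r * (deriv (fun a => φ a ^ 2 * pd1 U a θ / √(φ a ^ 2)) r +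
      deriv (fun b => pd2 U r b / φ r) θ) := by
    simp [lap, MetricCoeffs.laplacian, MetricCoeffs.disc, polarMetric, pd1, pd2, hs r hr,
      Real.sqrt_sq_eq_abs]
  rw [h2, h1, deriv_div_const]
  change _ = deriv (fun s => pd1 U s θ) r + _ + 1 / φ r ^ 2 * deriv (fun b => pd2 U r b) θ
  field_simp
  ring

end RotSurface

end

/-!
A function harmonic for `dr² + φ² dθ²` has Fourier modes `c exp (|n| T)`, where `T' = 1 / φ`: in the
conformal coordinate `exp (T + i θ)` the Laplacian is the flat one up to a factor.

Very negative curvature makes `φ' / φ` grow faster than `r^α` for some `α > 1`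
(`exists_rpow_mul_le_of_rpow_mul_le_second_deriv`). The radial solution of `Δu = 1` has
`u' = (1 / φ) ∫₀ʳ φ`, which is then `O(r^(-α))` (`exists_forall_le_of_rpow_mul_le_deriv`), so `u` is a
bounded biharmonic function that is not harmonic. It is smooth at the origin because it is a smooth
even function of `r` (`contDiff_comp_norm`), as `φ` extends to a smooth odd function on the line
(`contDiff_parityExt`).

If the curvature is at least `-η r²`, then `φ' / φ` grows at most linearly
(`exists_deriv_le_mul_of_second_deriv_le`). For biharmonic `u` the function `Δu` is harmonic and,
`φ` being a smooth profile, bounded near the origin (`exists_abs_lap_inPolar_le`), so each of its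
modes is a multiple `c exp (|n| T)` of the regular solution (`exists_eq_mul_exp_of_bounded`). The
corresponding mode of `u` is `v exp (|n| T)`, where `p v' = c ∫ p + const` and `p = φ exp (2 |n| T)`.
Since `p' / p` is `O(r)`, the quotient `(1 / p) ∫ p` is at least of order `1 / r`, and `v` grows at
least like `log r` unless `c = 0` (`eq_zero_of_bounded_of_mode_equation`). Thus for bounded `u` all
modes of `Δu` vanish.
-/

/-! ### Integrals depending on a parameter -/

/-- Differentiation under the integral sign over a compact interval, when the partial derivative is
jointly continuous on an open set of parameters. -/
theorem hasDerivAt_intervalIntegral_of_continuousOn {F F' : ℝ → ℝ → ℝ} {s : Set ℝ} (hs : IsOpen s)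
    (a b : ℝ) (hF : ContinuousOn (Function.uncurry F) (s ×ˢ Set.univ))
    (hF' : ContinuousOn (Function.uncurry F') (s ×ˢ Set.univ))
    (hd : ∀ r ∈ s, ∀ t, HasDerivAt (fun x => F x t) (F' r t) r) {r : ℝ} (hr : r ∈ s) :
    HasDerivAt (fun x => ∫ t in a..b, F x t) (∫ t in a..b, F' r t) r := by
  obtain ⟨δ, hδ, hsub⟩ := Metric.nhds_basis_closedBall.mem_iff.1 (hs.mem_nhds hr)
  obtain ⟨C, hC⟩ :=
    ((isCompact_closedBall r δ).prod (isCompact_uIcc (a := a) (b := b))).exists_bound_of_continuousOn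
    (hF'.mono (Set.prod_mono hsub (Set.subset_univ _)))
  have hcont : ∀ {G : ℝ → ℝ → ℝ}, ContinuousOn (Function.uncurry G) (s ×ˢ Set.univ) →
      ∀ x ∈ s, Continuous (G x) := by
    intro G hG x hx
    rw [← continuousOn_univ]
    exact hG.comp (f := fun t => (x, t)) (by fun_prop) (fun t _ => ⟨hx, trivial⟩)
  refine (intervalIntegral.hasDerivAt_integral_of_dominated_loc_of_deriv_le
    (F := F) (F' := F') (bound := fun _ => C) (Metric.closedBall_mem_nhds r hδ) ?_
    ((hcont hF r hr).intervalIntegrable _ _) (hcont hF' r hr).aestronglyMeasurable ?_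
    (by simp) ?_).2
  · filter_upwards [hs.mem_nhds hr] with x hx using (hcont hF x hx).aestronglyMeasurable
  · exact Filter.Eventually.of_forall fun t ht x hx =>
      hC (x, t) ⟨hx, Set.uIoc_subset_uIcc ht⟩
  · exact Filter.Eventually.of_forall fun t _ x hx => hd x (hsub hx) t

theorem contDiff_integral_pow_mul_comp_mul {F : ℝ → ℝ} (hF : ContDiff ℝ ∞ F) (m : ℕ) :
    ContDiff ℝ ∞ fun r => ∫ t in (0 : ℝ)..1, t ^ m * F (t * r) := by
  have hder : ∀ (m : ℕ) (F : ℝ → ℝ), ContDiff ℝ ∞ F → ∀ r,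
      HasDerivAt (fun r => ∫ t in (0 : ℝ)..1, t ^ m * F (t * r))
        (∫ t in (0 : ℝ)..1, t ^ (m + 1) * deriv F (t * r)) r := by
    intro m F hF r
    have h1 : Continuous F := hF.continuous
    have h2 : Continuous (deriv F) := hF.continuous_deriv (by simp)
    refine hasDerivAt_intervalIntegral_of_continuousOn (F := fun r t => t ^ m * F (t * r))
      (F' := fun r t => t ^ (m + 1) * deriv F (t * r)) isOpen_univ 0 1 ?_ ?_ ?_
      (Set.mem_univ r)
    · exact Continuous.continuousOn (by unfold Function.uncurry; fun_prop)
    · exact Continuous.continuousOn (by unfold Function.uncurry; fun_prop)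
    · intro r _ t
      have h := (hF.differentiable (by simp) (t * r)).hasDerivAt.comp r
        ((hasDerivAt_id r).const_mul t)
      refine (h.const_mul (t ^ m)).congr_deriv ?_
      ring
  refine contDiff_infty.2 fun n => ?_
  induction n generalizing m F with
  | zero =>
    exact contDiff_zero.2 (continuous_iff_continuousAt.2 fun r => (hder m F hF r).continuousAt)
  | succ n ih =>
    push_cast
    refine contDiff_succ_iff_deriv.2 ⟨fun r => (hder m F hF r).differentiableAt, by simp, ?_⟩
    rw [funext fun r => (hder m F hF r).deriv]
    exact ih (contDiff_infty_iff_deriv.1 hF).2 (m + 1)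

/-! ### Smooth functions of definite parity -/

theorem Function.Even.deriv_odd {g : ℝ → ℝ} (hg : g.Even) : (deriv g).Odd := by
  intro r
  have h := deriv_comp_neg g (-r)
  rw [funext fun x => hg x, neg_neg] at h
  exact h

/-- Hadamard's lemma for odd functions: the quotient is `k r = ∫₀¹ F' (t r) dt`. -/
theorem exists_contDiff_even_eq_mul {F : ℝ → ℝ} (hF : ContDiff ℝ ∞ F) (hodd : F.Odd) :
    ∃ k : ℝ → ℝ, ContDiff ℝ ∞ k ∧ k.Even ∧ ∀ r, F r = r * k r := by
  have hk : ∀ r, F r = r * ∫ t in (0 : ℝ)..1, t ^ 0 * deriv F (t * r) := by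
    intro r
    have hc : Continuous (deriv F) := hF.continuous_deriv (by simp)
    have h := intervalIntegral.integral_eq_sub_of_hasDerivAt (a := 0) (b := 1)
      (f := fun t => F (t * r)) (f' := fun t => deriv F (t * r) * r)
      (fun t _ => ((hF.differentiable (by simp) (t * r)).hasDerivAt.comp t
        ((hasDerivAt_id t).mul_const r)).congr_deriv (by simp))
      ((by fun_prop : Continuous fun t => deriv F (t * r) * r).intervalIntegrable _ _)
    rw [intervalIntegral.integral_mul_const] at h
    simp only [one_mul, zero_mul, hodd.map_zero, sub_zero] at h
    simp only [pow_zero, one_mul, ← h]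
    ring
  refine ⟨_, contDiff_integral_pow_mul_comp_mul (contDiff_infty_iff_deriv.1 hF).2 0, ?_, hk⟩
  intro r
  rcases eq_or_ne r 0 with rfl | hr
  · simp
  · have h := hodd r
    rw [hk r, hk (-r)] at h
    exact mul_left_cancel₀ hr (by linarith)

/-- The primitive `∫₀ʳ s a(s) ds` of `r a(r)` is `r²` times the even function
`b r = ∫₀¹ t a(t r) dt`. -/
theorem exists_contDiff_even_hasDerivAt_sq_mul {a : ℝ → ℝ} (ha : ContDiff ℝ ∞ a) (hev : a.Even) :
    ∃ b : ℝ → ℝ, ContDiff ℝ ∞ b ∧ b.Even ∧ ∀ r, HasDerivAt (fun s => s ^ 2 * b s) (r * a r) r := by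
  refine ⟨_, contDiff_integral_pow_mul_comp_mul ha 1, fun r => by simp [hev.eq], fun r => ?_⟩
  have e : (fun s => s ^ 2 * ∫ t in (0 : ℝ)..1, t ^ 1 * a (t * s)) =
      fun s => ∫ x in (0 : ℝ)..s, x * a x := by
    funext s
    have h := intervalIntegral.smul_integral_comp_mul_right (fun x => x * a x) s (a := 0) (b := 1)
    simp only [zero_mul, one_mul] at h
    rw [← h, smul_eq_mul, sq, mul_assoc, ← intervalIntegral.integral_const_mul]
    congr 2
    funext t
    ring
  have hc : Continuous fun x => x * a x := continuous_id.mul ha.continuous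
  rw [e]
  exact intervalIntegral.integral_hasDerivAt_right (hc.intervalIntegrable _ _)
    (hc.stronglyMeasurableAtFilter _ _) hc.continuousAt

/-- Smooth even functions of the distance to the origin are smooth: with `g' r = r k r`, the
derivative of `g ‖x‖` is `k ‖x‖ ⟪x, ·⟫`, where `k` is again smooth and even. -/
theorem contDiff_comp_norm {E : Type*} [NormedAddCommGroup E] [InnerProductSpace ℝ E]
    {g : ℝ → ℝ} (hg : ContDiff ℝ ∞ g) (hev : g.Even) : ContDiff ℝ ∞ fun x : E => g ‖x‖ := by
  refine contDiff_infty.2 fun n => ?_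
  induction n generalizing g with
  | zero => exact contDiff_zero.2 (hg.continuous.comp continuous_norm)
  | succ n ih =>
    obtain ⟨k, hk, hkev, hgk⟩ :=
      exists_contDiff_even_eq_mul (contDiff_infty_iff_deriv.1 hg).2 hev.deriv_odd
    have hgd : ∀ r, HasDerivAt g (r * k r) r := fun r =>
      hgk r ▸ (hg.differentiable (by simp) r).hasDerivAt
    have hd : ∀ x : E, HasFDerivAt (fun x : E => g ‖x‖) (k ‖x‖ • innerSL ℝ x) x := by
      intro x
      rcases eq_or_ne x 0 with rfl | hx
      · have h := hasDerivAt_iff_isLittleO.1 (hgd 0)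
        rw [hasFDerivAt_iff_isLittleO_nhds_zero]
        have h2 := h.comp_tendsto (k := fun x : E => ‖x‖) (l' := nhds 0)
          (by simpa using (continuous_norm (E := E)).tendsto 0)
        rw [← Asymptotics.isLittleO_norm_right]
        simpa [Function.comp_def] using h2
      · have hx' : ‖x‖ ≠ 0 := norm_ne_zero_iff.2 hx
        have h1 := (hasStrictFDerivAt_norm_sq x).hasFDerivAt
        have h2 := (Real.hasDerivAt_sqrt (pow_ne_zero 2 hx')).comp_hasFDerivAt x h1
        have h3 := (Real.sqrt_sq (norm_nonneg x)).symm ▸ hgd ‖x‖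
        have h4 := HasDerivAt.comp_hasFDerivAt (f := fun y : E => √(‖y‖ ^ 2)) x h3 h2
        have e : (fun x : E => g ‖x‖) = g ∘ fun y : E => √(‖y‖ ^ 2) := by
          funext y
          simp
        rw [e]
        refine h4.congr_fderiv ?_
        ext y
        simp only [Real.sqrt_sq (norm_nonneg x), smul_smul, smul_apply,
          smul_eq_mul, ofNat_smul_eq_nsmul, nsmul_eq_mul]
        field_simp
        norm_num
    push_cast
    refine contDiff_succ_iff_fderiv.2 ⟨fun x => (hd x).differentiableAt, by simp, ?_⟩
    rw [funext fun x => (hd x).fderiv]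
    exact (ih hk hkev).smul (innerSL ℝ).contDiff

/-- The extension of a function on `[0, ∞)` to the line with `f (-r) = σ * f r`: the even
extension for `σ = 1` and the odd one for `σ = -1`. -/
noncomputable def parityExt (σ : ℝ) (f : ℝ → ℝ) (r : ℝ) : ℝ := if 0 ≤ r then f r else σ * f (-r)

/-- For `σ = ±1` the hypothesis says that the derivatives at `0` whose order has the parity
opposite to that of the extension vanish. It passes to the derivative of `f` with `-σ` in place of `σ`. -/
theorem contDiff_parityExt {σ : ℝ} {f : ℝ → ℝ} (hf : ContDiffOn ℝ ∞ f (Set.Ici 0))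
    (h0 : ∀ k : ℕ, iteratedDerivWithin k f (Set.Ici 0) 0 =
      σ * (-1) ^ k * iteratedDerivWithin k f (Set.Ici 0) 0) :
    ContDiff ℝ ∞ (parityExt σ f) := by
  have hder : ∀ (σ : ℝ) (f : ℝ → ℝ), ContDiffOn ℝ ∞ f (Set.Ici 0) →
      (∀ k : ℕ, iteratedDerivWithin k f (Set.Ici 0) 0 =
        σ * (-1) ^ k * iteratedDerivWithin k f (Set.Ici 0) 0) →
      ∀ r, HasDerivAt (parityExt σ f) (parityExt (-σ) (derivWithin f (Set.Ici 0)) r) r := by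
    intro σ f hf h0 r
    have hw : ∀ x, 0 ≤ x → HasDerivWithinAt f (derivWithin f (Set.Ici 0) x) (Set.Ici 0) x :=
      fun x hx => (hf.differentiableOn (by simp) x hx).hasDerivWithinAt
    have hpos : Set.EqOn (parityExt σ f) f (Set.Ici 0) := fun x hx => if_pos hx
    have hneg : Set.EqOn (parityExt σ f) (fun x => σ * f (-x)) (Set.Iic 0) := by
      intro x hx
      rcases eq_or_lt_of_le (show x ≤ 0 from hx) with rfl | hx
      · have := h0 0
        simp only [iteratedDerivWithin_zero, pow_zero, mul_one] at this
        simpa [parityExt] using this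
      · exact if_neg (not_le.2 hx)
    have hwneg : ∀ x, x ≤ 0 → HasDerivWithinAt (fun x => σ * f (-x))
        (-σ * derivWithin f (Set.Ici 0) (-x)) (Set.Iic 0) x := by
      intro x hx
      have := ((hw (-x) (by linarith)).scomp x (t' := Set.Ici 0) (s := Set.Iic 0)
        (hasDerivAt_neg x).hasDerivWithinAt
        (fun y hy => by simpa using hy)).const_mul σ
      refine this.congr_deriv ?_
      simp
    rcases lt_trichotomy r 0 with hr | rfl | hr
    · have e : parityExt (-σ) (derivWithin f (Set.Ici 0)) r =
        -σ * derivWithin f (Set.Ici 0) (-r) := if_neg (not_le.2 hr)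
      rw [e]
      exact ((hwneg r hr.le).congr hneg (hneg hr.le)).hasDerivAt (Iic_mem_nhds hr)
    · have e : parityExt (-σ) (derivWithin f (Set.Ici 0)) 0 = derivWithin f (Set.Ici 0) 0 :=
        if_pos le_rfl
      have h1 := h0 1
      simp only [iteratedDerivWithin_one, pow_one] at h1
      have hl := (hwneg 0 le_rfl).congr hneg (hneg (Set.mem_Iic.2 le_rfl))
      have hr := (hw 0 le_rfl).congr hpos (hpos (Set.mem_Ici.2 le_rfl))
      rw [e]
      have e2 : -σ * derivWithin f (Set.Ici 0) (-0) = derivWithin f (Set.Ici 0) 0 := by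
        rw [neg_zero]
        linarith
      rw [e2] at hl
      have := hl.union hr
      rwa [Set.Iic_union_Ici, hasDerivWithinAt_univ] at this
    · have e : parityExt (-σ) (derivWithin f (Set.Ici 0)) r = derivWithin f (Set.Ici 0) r :=
        if_pos hr.le
      rw [e]
      exact ((hw r hr.le).congr hpos (hpos hr.le)).hasDerivAt (Ici_mem_nhds hr)
  refine contDiff_infty.2 fun n => ?_
  induction n generalizing f σ with
  | zero =>
    exact contDiff_zero.2 (continuous_iff_continuousAt.2 fun r => (hder σ f hf h0 r).continuousAt)
  | succ n ih =>
    push_cast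
    refine contDiff_succ_iff_deriv.2 ⟨fun r => (hder σ f hf h0 r).differentiableAt, by simp, ?_⟩
    rw [funext fun r => (hder σ f hf h0 r).deriv]
    refine ih (hf.derivWithin (uniqueDiffOn_Ici 0) (by simp)) fun k => ?_
    rw [← iteratedDerivWithin_succ']
    have := h0 (k + 1)
    rw [pow_succ] at this
    linarith

namespace RotSurface

/-- A smooth profile has the form `φ r = r a(r)` with `a` smooth, even and positive on the whole line
and `a r = 1 + r² β(r)`, `β` smooth and even. All estimates at the origin come from this. -/
theorem IsSmoothProfile.exists_even_factor {φ : ℝ → ℝ} (h : IsSmoothProfile φ) :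
    ∃ a : ℝ → ℝ, ContDiff ℝ ∞ a ∧ a.Even ∧ (∀ r, 0 < a r) ∧
      (∀ r, 0 ≤ r → φ r = r * a r) ∧
      ∃ β : ℝ → ℝ, ContDiff ℝ ∞ β ∧ β.Even ∧ ∀ r, a r = 1 + r ^ 2 * β r := by
  have hsm : ContDiff ℝ ∞ (parityExt (-1) φ) := by
    refine contDiff_parityExt h.smooth fun k => ?_
    rcases Nat.even_or_odd' k with ⟨j, rfl | rfl⟩
    · rw [h.even_deriv_zero j, mul_zero]
    · rw [pow_succ, pow_mul]
      norm_num
  have hodd : (parityExt (-1) φ).Odd := by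
    intro r
    rcases lt_trichotomy r 0 with hr | rfl | hr
    · simp [parityExt, hr.le, not_le.2 hr]
    · simp [parityExt, h.map_zero]
    · simp [parityExt, hr.le, not_le.2 hr]
  obtain ⟨a, ha, hev, hφa⟩ := exists_contDiff_even_eq_mul hsm hodd
  have hφ : ∀ r, 0 ≤ r → φ r = r * a r := fun r hr => by rw [← hφa r]; simp [parityExt, hr]
  have ha0 : a 0 = 1 := by
    have h1 : HasDerivWithinAt (fun r => r * a r) (1 * a 0 + 0 * deriv a 0) (Set.Ici 0) 0 :=
      ((hasDerivAt_id' (0 : ℝ)).mul (ha.differentiable (by simp) 0).hasDerivAt).hasDerivWithinAt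
    have h2 := (h1.congr (fun x hx => hφ x hx) (hφ 0 le_rfl)).derivWithin
      (uniqueDiffOn_Ici 0 0 (Set.mem_Ici.2 le_rfl))
    rw [h.deriv_zero] at h2
    linarith
  have hpos : ∀ r, 0 < r → 0 < a r := fun r hr =>
    pos_of_mul_pos_right (hφ r hr.le ▸ h.pos r hr) hr.le
  obtain ⟨k, hk, hkev, hak⟩ :=
    exists_contDiff_even_eq_mul (contDiff_infty_iff_deriv.1 ha).2 hev.deriv_odd
  obtain ⟨β, hβ, hβev, hβd⟩ := exists_contDiff_even_hasDerivAt_sq_mul hk hkev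
  have haβ : ∀ r, a r = 1 + r ^ 2 * β r := by
    intro r
    have hd : ∀ r, HasDerivAt (fun r => a r - r ^ 2 * β r) 0 r := fun r =>
      ((ha.differentiable (by simp) r).hasDerivAt.sub (hβd r)).congr_deriv
        (by rw [hak r, sub_self])
    have := is_const_of_deriv_eq_zero (fun r => (hd r).differentiableAt) (fun r => (hd r).deriv) r 0
    simp only [ha0, ne_eq, OfNat.ofNat_ne_zero, not_false_eq_true, zero_pow, zero_mul] at this
    linarith
  refine ⟨a, ha, hev, fun r => ?_, hφ, β, hβ, hβev, haβ⟩
  rcases lt_trichotomy r 0 with hr | rfl | hr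
  · rw [← hev r]
    exact hpos _ (neg_pos.2 hr)
  · simp [ha0]
  · exact hpos r hr

end RotSurface

/-! ### Monotonicity on half-lines -/

theorem monotoneOn_Ici_of_hasDerivAt {f f' : ℝ → ℝ} {a : ℝ}
    (h : ∀ x, a ≤ x → HasDerivAt f (f' x) x) (h0 : ∀ x, a ≤ x → 0 ≤ f' x) :
    MonotoneOn f (Set.Ici a) := by
  refine monotoneOn_of_deriv_nonneg (convex_Ici a)
    (fun x hx => (h x hx).continuousAt.continuousWithinAt)
    (fun x hx => ?_) (fun x hx => ?_)
  · rw [interior_Ici] at hx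
    exact (h x (le_of_lt hx)).differentiableAt.differentiableWithinAt
  · rw [interior_Ici] at hx
    rw [(h x (le_of_lt hx)).deriv]
    exact h0 x (le_of_lt hx)

theorem antitoneOn_Ici_of_hasDerivAt {f f' : ℝ → ℝ} {a : ℝ}
    (h : ∀ x, a ≤ x → HasDerivAt f (f' x) x) (h0 : ∀ x, a ≤ x → f' x ≤ 0) :
    AntitoneOn f (Set.Ici a) := by
  have := monotoneOn_Ici_of_hasDerivAt (fun x hx => (h x hx).neg)
    (fun x hx => neg_nonneg.2 (h0 x hx))
  simpa using this.neg

/-- If `φ'' ≥ r^(2α) φ`, then the logarithmic derivative of `φ` is at least `δ r^α` for large `r`. -/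
theorem exists_rpow_mul_le_of_rpow_mul_le_second_deriv {φ φ' φ'' : ℝ → ℝ} {α r₀ : ℝ} (hα : 1 ≤ α)
    (hr₀ : 0 < r₀) (h0 : ∀ r, r₀ ≤ r → 0 < φ r) (h1 : ∀ r, r₀ ≤ r → HasDerivAt φ (φ' r) r)
    (h2 : ∀ r, r₀ ≤ r → HasDerivAt φ' (φ'' r) r) (hmono : ∀ r, r₀ ≤ r → 0 ≤ φ' r)
    (hcurv : ∀ r, r₀ ≤ r → (r ^ α) ^ 2 * φ r ≤ φ'' r) :
    ∃ δ r₁ : ℝ, 0 < δ ∧ r₀ ≤ r₁ ∧ ∀ r, r₁ ≤ r → δ * r ^ α * φ r ≤ φ' r := by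
  set r₁ := max (r₀ + 1) α with hr₁
  have hr01 : r₀ < r₁ := lt_of_lt_of_le (by linarith) (le_max_left _ _)
  have hr₁α : α ≤ r₁ := le_max_right _ _
  -- `φ'` increases strictly from a nonnegative value, so a small `δ` has `φ' ≥ δ rᵅ φ` at `r₁`.
  have hpos : 0 < φ' r₁ := by
    refine lt_of_le_of_lt (hmono r₀ le_rfl) ?_
    refine strictMonoOn_of_deriv_pos (convex_Ici r₀)
      (fun x hx => (h2 x hx).continuousAt.continuousWithinAt) (fun x hx => ?_)
      (Set.mem_Ici.2 le_rfl) (Set.mem_Ici.2 hr01.le) hr01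
    rw [interior_Ici] at hx
    have hx' : r₀ ≤ x := le_of_lt hx
    rw [(h2 x hx').deriv]
    have := h0 x hx'
    have : 0 < x := by linarith
    exact lt_of_lt_of_le (by positivity) (hcurv x hx')
  have hφ₁ := h0 r₁ hr01.le
  have hr₁pos : 0 < r₁ := by linarith
  have hp₁ : 0 < r₁ ^ α * φ r₁ := by positivity
  set δ := min (1 / 2) (φ' r₁ / (r₁ ^ α * φ r₁)) with hδ
  have hδpos : 0 < δ := lt_min (by norm_num) (by positivity)
  have hδhalf : δ ≤ 1 / 2 := min_le_left _ _
  refine ⟨δ, r₁, hδpos, hr01.le, fun r hr => ?_⟩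
  -- The linear differential inequality `z' ≥ -δ rᵅ z` for `z = φ' - δ rᵅ φ`.
  have hder : ∀ x, r₁ ≤ x → HasDerivAt
      (fun x => (φ' x - δ * x ^ α * φ x) * Real.exp (δ * x ^ (α + 1) / (α + 1)))
      ((φ'' x - (δ * α * x ^ (α - 1) + δ ^ 2 * (x ^ α) ^ 2) * φ x) *
        Real.exp (δ * x ^ (α + 1) / (α + 1))) x := by
    intro x hx
    have hx0 : 0 < x := by linarith
    have d1 : HasDerivAt (fun x : ℝ => δ * x ^ α) (δ * (α * x ^ (α - 1))) x :=
      (Real.hasDerivAt_rpow_const (Or.inl hx0.ne')).const_mul δ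
    have d2 : HasDerivAt (fun x : ℝ => δ * x ^ (α + 1) / (α + 1)) (δ * x ^ α) x := by
      have := ((Real.hasDerivAt_rpow_const (p := α + 1) (Or.inl hx0.ne')).const_mul δ).div_const
        (α + 1)
      refine this.congr_deriv ?_
      rw [add_sub_cancel_right]
      field_simp
    have := ((h2 x (by linarith)).sub (d1.mul (h1 x (by linarith)))).mul d2.exp
    refine this.congr_deriv ?_
    simp only [Pi.sub_apply, Pi.mul_apply]
    ring
  have hm := monotoneOn_Ici_of_hasDerivAt hder (fun x hx => by
    have hx1 : 1 ≤ x := by linarith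
    have hx0 : 0 < x := by linarith
    have e1 : (x ^ α) ^ 2 = x ^ (α - 1) * x ^ (α + 1) := by
      rw [sq, ← Real.rpow_add hx0, ← Real.rpow_add hx0]
      congr 1
      ring
    have e2 : α ≤ x ^ (α + 1) := by
      calc α ≤ x := by linarith
        _ = x ^ (1 : ℝ) := (Real.rpow_one x).symm
        _ ≤ x ^ (α + 1) := Real.rpow_le_rpow_of_exponent_le hx1 (by linarith)
    have hp : 0 < x ^ (α - 1) := by positivity
    have e3 : α * x ^ (α - 1) ≤ (x ^ α) ^ 2 := by
      rw [e1, mul_comm]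
      exact mul_le_mul_of_nonneg_left e2 hp.le
    have e4 : δ * α * x ^ (α - 1) + δ ^ 2 * (x ^ α) ^ 2 ≤ (x ^ α) ^ 2 := by
      have h5 : δ * (α * x ^ (α - 1)) ≤ 1 / 2 * (x ^ α) ^ 2 :=
        mul_le_mul hδhalf e3 (by positivity) (by norm_num)
      have h6 : δ ^ 2 ≤ 1 / 2 := by nlinarith
      nlinarith [mul_le_mul_of_nonneg_right h6 (sq_nonneg (x ^ α))]
    have h7 := mul_le_mul_of_nonneg_right e4 (h0 x (by linarith)).le
    have h8 := hcurv x (by linarith)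
    exact mul_nonneg (by linarith) (Real.exp_pos _).le)
  have h3 := hm (Set.mem_Ici.2 le_rfl) (Set.mem_Ici.2 hr) hr
  have h4 : 0 ≤ φ' r₁ - δ * r₁ ^ α * φ r₁ := by
    have := mul_le_mul_of_nonneg_right (min_le_right (1 / 2) (φ' r₁ / (r₁ ^ α * φ r₁))) hp₁.le
    rw [← hδ, div_mul_cancel₀ _ hp₁.ne'] at this
    linarith
  have h5 := le_trans (mul_nonneg h4 (Real.exp_pos _).le) h3
  have := nonneg_of_mul_nonneg_left h5 (Real.exp_pos _)
  linarith

/-- If `φ' / φ` grows at least like `r^α` with `α > 1`, then `Φ / φ`, for a primitive `Φ` of `φ`, is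
`O(r^(-α))`, so that its primitive `f` is bounded above. -/
theorem exists_forall_le_of_rpow_mul_le_deriv {φ φ' Φ f : ℝ → ℝ} {α δ r₀ : ℝ} (hα : 1 < α)
    (hδ : 0 < δ) (hr₀ : 0 < r₀) (h0 : ∀ r, r₀ ≤ r → 0 < φ r)
    (h1 : ∀ r, r₀ ≤ r → HasDerivAt φ (φ' r) r) (hφ' : ∀ r, r₀ ≤ r → δ * r ^ α * φ r ≤ φ' r)
    (hΦ : ∀ r, r₀ ≤ r → HasDerivAt Φ (φ r) r)
    (hf : ∀ r, r₀ ≤ r → HasDerivAt f (Φ r / φ r) r) :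
    ∃ B r₁ : ℝ, r₀ ≤ r₁ ∧ ∀ r, r₁ ≤ r → f r ≤ B := by
  obtain ⟨r₁, h01, h11, hr₁⟩ : ∃ r₁, r₀ ≤ r₁ ∧ 1 ≤ r₁ ∧ 2 * α / δ ≤ r₁ :=
    ⟨max r₀ (max 1 (2 * α / δ)), by simp, by simp, by simp⟩
  have hφ₁ := h0 r₁ h01
  obtain ⟨C, hC1, hC2⟩ : ∃ C, 2 / δ ≤ C ∧ Φ r₁ / (r₁ ^ (-α) * φ r₁) ≤ C :=
    ⟨max _ _, le_max_left _ _, le_max_right _ _⟩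
  have hCpos : 0 < C := lt_of_lt_of_le (by positivity) hC1
  -- `C` is large enough for `Φ - C r^(-α) φ` to be nonpositive at `r₁` and antitone from there on.
  have hanti := antitoneOn_Ici_of_hasDerivAt (a := r₁) (f := fun r => Φ r - C * r ^ (-α) * φ r)
    (f' := fun r => φ r + C * α * r ^ (-α - 1) * φ r - C * r ^ (-α) * φ' r)
    (fun x hx => by
      have hx0 : 0 < x := by linarith
      have d1 := (Real.hasDerivAt_rpow_const (p := -α) (Or.inl hx0.ne')).const_mul C
      refine ((hΦ x (by linarith)).sub (d1.mul (h1 x (by linarith)))).congr_deriv ?_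
      ring)
    (fun x hx => by
      have hx0 : 0 < x := by linarith
      have e1 : x ^ (-α - 1) ≤ x ^ (-1 : ℝ) :=
        Real.rpow_le_rpow_of_exponent_le (by linarith) (by linarith)
      have e2 : α * x ^ (-α - 1) ≤ δ / 2 := by
        rw [Real.rpow_neg_one] at e1
        have : α * x⁻¹ ≤ δ / 2 := by
          rw [← div_eq_mul_inv, div_le_iff₀ hx0]
          have := (div_le_iff₀ hδ).1 (hr₁.trans hx)
          linarith
        exact (mul_le_mul_of_nonneg_left e1 (by linarith)).trans this
      have e3 : r₁ ≤ x → δ * φ x ≤ x ^ (-α) * φ' x := fun _ => by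
        have := mul_le_mul_of_nonneg_left (hφ' x (by linarith)) (Real.rpow_pos_of_pos hx0 (-α)).le
        have e : x ^ (-α) * x ^ α = 1 := by rw [← Real.rpow_add hx0]; simp
        calc δ * φ x = (x ^ (-α) * x ^ α) * (δ * φ x) := by rw [e, one_mul]
          _ = x ^ (-α) * (δ * x ^ α * φ x) := by ring
          _ ≤ _ := this
      have h3 := mul_le_mul_of_nonneg_left (e3 hx) hCpos.le
      have hφx := h0 x (by linarith)
      have h4 := mul_le_mul_of_nonneg_left (mul_le_mul_of_nonneg_right e2 hφx.le) hCpos.le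
      have h5 : 1 ≤ C * δ / 2 := by
        rw [div_le_iff₀ hδ] at hC1
        linarith
      have h6 := mul_le_mul_of_nonneg_right h5 hφx.le
      nlinarith)
  have hq : ∀ r, r₁ ≤ r → Φ r / φ r ≤ C * r ^ (-α) := by
    intro r hr
    have h3 := hanti (Set.mem_Ici.2 le_rfl) (Set.mem_Ici.2 hr) hr
    have hr₁pos : 0 < r₁ := by linarith
    rw [div_le_iff₀ (by positivity)] at hC2
    rw [div_le_iff₀ (h0 r (by linarith))]
    simp only at h3
    linarith
  have hanti2 := antitoneOn_Ici_of_hasDerivAt (a := r₁)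
    (f := fun r => f r + C / (α - 1) * r ^ (1 - α)) (f' := fun r => Φ r / φ r - C * r ^ (-α))
    (fun x hx => by
      have hx0 : 0 < x := by linarith
      have d1 := (Real.hasDerivAt_rpow_const (p := 1 - α) (Or.inl hx0.ne')).const_mul (C / (α - 1))
      refine ((hf x (by linarith)).add d1).congr_deriv ?_
      have : α - 1 ≠ 0 := by linarith
      rw [show 1 - α - 1 = -α by ring]
      field_simp
      ring)
    (fun x hx => sub_nonpos.2 (hq x hx))
  refine ⟨f r₁ + C / (α - 1) * r₁ ^ (1 - α), r₁, h01, fun r hr => ?_⟩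
  have h3 := hanti2 (Set.mem_Ici.2 le_rfl) (Set.mem_Ici.2 hr) hr
  have h4 : 0 ≤ C / (α - 1) * r ^ (1 - α) := by
    have : 0 < α - 1 := by linarith
    have : 0 ≤ r := by linarith
    positivity
  simp only at h3
  linarith

namespace RotSurface

theorem norm_polarPt (r θ : ℝ) : ‖polarPt r θ‖ = |r| := by
  rw [EuclideanSpace.norm_eq, ← Real.sqrt_sq_eq_abs]
  congr 1
  simp only [polarPt, Fin.sum_univ_two, Real.norm_eq_abs, sq_abs]
  simp only [Matrix.cons_val_zero, Matrix.cons_val_one]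
  nlinarith [Real.sin_sq_add_cos_sq θ]

theorem exists_forall_polarPt_notMem {C : Set Plane} (hC : IsCompact C) :
    ∃ r₀ : ℝ, 0 < r₀ ∧ ∀ r θ, r₀ ≤ r → polarPt r θ ∉ C := by
  obtain ⟨M, hM, hCM⟩ := hC.isBounded.exists_pos_norm_le
  refine ⟨M + 1, by linarith, fun r θ hr hmem => ?_⟩
  have := hCM _ hmem
  rw [norm_polarPt] at this
  linarith [le_abs_self r]

theorem deriv_nonneg_of_monotoneOn_Ici {φ : ℝ → ℝ} {R : ℝ} (hmono : MonotoneOn φ (Set.Ici R))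
    {r : ℝ} (hr : R < r) : 0 ≤ deriv φ r := by
  rw [← derivWithin_of_mem_nhds (Ici_mem_nhds hr)]
  exact hmono.derivWithin_nonneg

/-- The radial solution `f` of `Δf = 1`, that is `f' = Φ / φ` with `Φ r = ∫₀ʳ φ`. -/
theorem IsSmoothProfile.exists_solution_laplacian_eq_one {φ : ℝ → ℝ} (h : IsSmoothProfile φ) :
    ∃ f Φ : ℝ → ℝ, ContDiff ℝ ∞ f ∧ f.Even ∧ ∀ r, 0 < r →
      0 ≤ Φ r ∧ HasDerivAt Φ (φ r) r ∧ HasDerivAt f (Φ r / φ r) r := by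
  obtain ⟨a, ha, haev, hapos, hφ, -⟩ := h.exists_even_factor
  obtain ⟨b, hb, hbev, hΦ⟩ := exists_contDiff_even_hasDerivAt_sq_mul ha haev
  obtain ⟨c, hc, hcev, hf⟩ := exists_contDiff_even_hasDerivAt_sq_mul (a := fun r => b r / a r)
    (hb.div ha fun r => (hapos r).ne') (fun r => by simp only [hbev r, haev r])
  refine ⟨fun r => r ^ 2 * c r, fun r => r ^ 2 * b r, by fun_prop, fun r => by simp [hcev.eq],
    fun r hr => ⟨?_, ?_, ?_⟩⟩
  · have hm := monotoneOn_Ici_of_hasDerivAt (a := 0) (fun x _ => hΦ x)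
      (fun x hx => mul_nonneg hx (hapos x).le)
    simpa using hm (Set.mem_Ici.2 le_rfl) (Set.mem_Ici.2 hr.le) hr.le
  · rw [hφ r hr.le]
    exact hΦ r
  · refine (hf r).congr_deriv ?_
    rw [hφ r hr.le]
    have := (hapos r).ne'
    field_simp

/-- The radial solution of `Δu = 1` is biharmonic and not harmonic. It is bounded where the curvature
is at most `-r^(2 + ε)`. -/
theorem IsSmoothProfile.exists_biharmonic {φ : ℝ → ℝ} (h : IsSmoothProfile φ)
    (hmono : ∃ R : ℝ, MonotoneOn φ (Set.Ici R)) {ε : ℝ} (hε : 0 < ε)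
    (hK : ∃ C : Set Plane, IsCompact C ∧ ∀ r θ : ℝ, 0 < r → polarPt r θ ∉ C →
      curv φ r θ ≤ -(r ^ (2 + ε))) :
    ∃ u : Plane → ℝ, IsBiharmonic φ u ∧ IsBoundedFun u ∧ ¬ IsHarmonic φ u := by
  obtain ⟨R, hR⟩ := hmono
  obtain ⟨C, hC, hK⟩ := hK
  obtain ⟨rC, hrC, hCout⟩ := exists_forall_polarPt_notMem hC
  obtain ⟨f, Φ, hfs, hfev, hf⟩ := h.exists_solution_laplacian_eq_one
  have hpolar : inPolar (fun x => f ‖x‖) = fun r _ => f r := by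
    funext r θ
    simp only [inPolar, norm_polarPt]
    rcases abs_choice r with hr | hr <;> rw [hr]
    exact hfev r
  have hp1 : ∀ r θ : ℝ, 0 < r → pd1 (fun r _ => f r) r θ = Φ r / φ r :=
    fun r θ hr => (hf r hr).2.2.deriv
  have hlap : ∀ r θ : ℝ, 0 < r → lap φ (inPolar fun x => f ‖x‖) r θ = 1 := by
    intro r θ hr
    have hφ := (h.pos r hr).ne'
    have hd := (hf r hr).2.1.div (h.hasDerivAt hr) hφ
    have e : (fun s => pd1 (fun r _ => f r) s θ) =ᶠ[nhds r] fun s => Φ s / φ s := by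
      filter_upwards [Ioi_mem_nhds hr] with s hs using hp1 s θ hs
    have hd' := hd.congr_of_eventuallyEq e
    rw [hpolar, lap_eq h hr θ hd'.differentiableAt, hp1 r θ hr]
    have e1 : pd1 (pd1 fun r _ => f r) r θ = _ := hd'.deriv
    have e2 : pd2 (pd2 fun r _ => f r) r θ = 0 := by simp [pd2]
    rw [e1, e2]
    field_simp
    ring
  have hlap2 : ∀ r θ : ℝ, 0 < r → lap φ (lap φ (inPolar fun x => f ‖x‖)) r θ = 0 := by
    intro r θ hr
    have e : ∀ s θ, 0 < s → pd1 (lap φ (inPolar fun x => f ‖x‖)) s θ = 0 := by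
      intro s θ hs
      have : (fun x => lap φ (inPolar fun x => f ‖x‖) x θ) =ᶠ[nhds s] fun _ => 1 := by
        filter_upwards [Ioi_mem_nhds hs] with x hx using hlap x θ hx
      rw [pd1, this.deriv_eq, deriv_const]
    have e' : (fun s => pd1 (lap φ (inPolar fun x => f ‖x‖)) s θ) =ᶠ[nhds r] fun _ => 0 := by
      filter_upwards [Ioi_mem_nhds hr] with x hx using e x θ hx
    have e1 : pd1 (pd1 (lap φ (inPolar fun x => f ‖x‖))) r θ = 0 := by
      rw [pd1, e'.deriv_eq, deriv_const]
    have e2 : pd2 (pd2 (lap φ (inPolar fun x => f ‖x‖))) r θ = 0 := by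
      have : ∀ t, lap φ (inPolar fun x => f ‖x‖) r t = 1 := fun t => hlap r t hr
      simp [pd2, this]
    rw [lap_eq h hr θ ((differentiableAt_const (0 : ℝ)).congr_of_eventuallyEq e'), e1, e2, e r θ hr]
    simp
  have hu : ContDiff ℝ ∞ fun x : Plane => f ‖x‖ := contDiff_comp_norm hfs hfev
  refine ⟨fun x => f ‖x‖, ⟨by exact_mod_cast contDiff_infty.1 hu 4, hlap2⟩, ?_, fun hh => ?_⟩
  swap
  · have := hh.2 1 0 one_pos
    rw [hlap 1 0 one_pos] at this
    exact one_ne_zero this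
  set r₀ := max rC (R + 1) with hr₀
  have hr₀C : rC ≤ r₀ := le_max_left _ _
  have hr₀R : R + 1 ≤ r₀ := le_max_right _ _
  have hr₀pos : 0 < r₀ := by linarith
  have hcurv : ∀ r, r₀ ≤ r → (r ^ (1 + ε / 2)) ^ 2 * φ r ≤ deriv (deriv φ) r := by
    intro r hr
    have hr0 : 0 < r := by linarith
    have h1 := hK r 0 hr0 (hCout r 0 (by linarith))
    rw [curv_eq h hr0, neg_div, neg_le_neg_iff, le_div_iff₀ (h.pos r hr0)] at h1
    rwa [← Real.rpow_natCast, ← Real.rpow_mul hr0.le,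
      show (1 + ε / 2) * ((2 : ℕ) : ℝ) = 2 + ε by push_cast; ring]
  obtain ⟨δ, r₁, hδ, h01, hδ'⟩ := exists_rpow_mul_le_of_rpow_mul_le_second_deriv
    (α := 1 + ε / 2) (by linarith) hr₀pos (fun r hr => h.pos r (by linarith))
    (fun r hr => h.hasDerivAt (by linarith)) (fun r hr => h.hasDerivAt_deriv (by linarith))
    (fun r hr => deriv_nonneg_of_monotoneOn_Ici hR (by linarith)) hcurv
  obtain ⟨B, r₂, h12, hB⟩ := exists_forall_le_of_rpow_mul_le_deriv (φ := φ) (Φ := Φ) (f := f)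
    (α := 1 + ε / 2) (by linarith) hδ (hr₀pos.trans_le h01) (fun r hr => h.pos r (by linarith))
    (fun r hr => h.hasDerivAt (by linarith)) hδ' (fun r hr => (hf r (by linarith)).2.1)
    (fun r hr => (hf r (by linarith)).2.2)
  have hm := monotoneOn_Ici_of_hasDerivAt (a := r₂) (fun x hx => (hf x (by linarith)).2.2)
    (fun x hx => div_nonneg (hf x (by linarith)).1 (h.pos x (by linarith)).le)
  obtain ⟨M, hM⟩ := (isCompact_Icc (a := 0) (b := r₂)).exists_bound_of_continuousOn
    hfs.continuous.continuousOn
  refine ⟨max M (max |B| |f r₂|), fun x => ?_⟩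
  rcases le_total ‖x‖ r₂ with hx | hx
  · exact (hM _ ⟨norm_nonneg x, hx⟩).trans (le_max_left _ _)
  · refine le_trans ?_ (le_max_right _ _)
    rw [max_comm]
    exact abs_le_max_abs_abs (hm (Set.mem_Ici.2 le_rfl) (Set.mem_Ici.2 hx) hx) (hB _ hx)

end RotSurface

/-! ### The radial equations of the Fourier modes -/

theorem eq_of_forall_hasDerivAt_zero_Ioi {f : ℝ → ℝ} (h : ∀ r, 0 < r → HasDerivAt f 0 r) {r : ℝ}
    (hr : 0 < r) : f r = f 1 :=
  isOpen_Ioi.is_const_of_deriv_eq_zero (convex_Ioi 0).isPreconnected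
    (fun x hx => (h x hx).differentiableAt.differentiableWithinAt) (fun x hx => (h x hx).deriv)
    (Set.mem_Ioi.2 hr) (Set.mem_Ioi.2 one_pos)

/-- Solutions of the first-order equation `φ g' = κ g`; `T` is a primitive of `1 / φ`. -/
theorem eq_mul_exp_of_hasDerivAt {φ T g : ℝ → ℝ} {κ : ℝ}
    (hT : ∀ r, 0 < r → HasDerivAt T (1 / φ r) r)
    (hg : ∀ r, 0 < r → HasDerivAt g (κ / φ r * g r) r) :
    ∃ c, ∀ r, 0 < r → g r = c * Real.exp (κ * T r) := by
  refine ⟨g 1 * Real.exp (-(κ * T 1)), fun r hr => ?_⟩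
  have := eq_of_forall_hasDerivAt_zero_Ioi (f := fun r => g r * Real.exp (-(κ * T r)))
    (fun x hx => ((hg x hx).mul ((hT x hx).const_mul κ).neg.exp).congr_deriv (by ring)) hr
  rw [← this, mul_assoc, ← Real.exp_add]
  simp

/-- With `D = φ d/dr`, the radial equation of the Fourier mode of frequency `κ` of a harmonic function
is `(D - κ) (D + κ) h = 0`. Its solutions that are bounded near the origin are the multiples of
`exp (κ T)`, because `T → -∞` there. -/
theorem exists_eq_mul_exp_of_bounded {φ φ' T h h' : ℝ → ℝ} {κ M : ℝ} (hκ : 0 ≤ κ)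
    (hφ : ∀ r, 0 < r → 0 < φ r) (hφ' : ∀ r, 0 < r → HasDerivAt φ (φ' r) r)
    (hT : ∀ r, 0 < r → HasDerivAt T (1 / φ r) r)
    (hT0 : Filter.Tendsto T (nhdsWithin 0 (Set.Ioi 0)) Filter.atBot)
    (hh : ∀ r, 0 < r → HasDerivAt h (h' r) r)
    (hh' : ∀ r, 0 < r → HasDerivAt h' (κ ^ 2 / φ r ^ 2 * h r - φ' r / φ r * h' r) r)
    (hM : ∀ r, 0 < r → r ≤ 1 → |h r| ≤ M) :
    ∃ c, ∀ r, 0 < r → h r = c * Real.exp (κ * T r) := by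
  have hflux : ∀ r, 0 < r → HasDerivAt (fun r => φ r * h' r) (κ ^ 2 / φ r * h r) r := by
    intro r hr
    refine ((hφ' r hr).mul (hh' r hr)).congr_deriv ?_
    have := (hφ r hr).ne'
    field_simp
    ring
  have hnear : ∀ᶠ r in nhdsWithin (0 : ℝ) (Set.Ioi 0), 0 < r ∧ |h r| ≤ M ∧ T r ≤ 0 := by
    filter_upwards [self_mem_nhdsWithin,
      mem_nhdsWithin_of_mem_nhds (Iic_mem_nhds (zero_lt_one' ℝ)),
      hT0.eventually_le_atBot 0] with r h1 h2 h3 using ⟨h1, hM r h1 h2, h3⟩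
  rcases hκ.eq_or_lt with rfl | hκ
  · obtain ⟨a, h1⟩ : ∃ a, ∀ r, 0 < r → φ r * h' r = a := ⟨φ 1 * h' 1, fun r hr =>
      eq_of_forall_hasDerivAt_zero_Ioi (fun x hx => (hflux x hx).congr_deriv (by simp)) hr⟩
    have h2 : ∀ r, 0 < r → h r - a * T r = h 1 - a * T 1 := fun r hr =>
      eq_of_forall_hasDerivAt_zero_Ioi (f := fun r => h r - a * T r) (fun x hx =>
        ((hh x hx).sub ((hT x hx).const_mul a)).congr_deriv (by
          have := (hφ x hx).ne'
          rw [← h1 x hx]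
          field_simp
          ring)) hr
    have ha : a = 0 := by
      by_contra ha
      have ht : Filter.Tendsto (fun r => |a| * -T r) (nhdsWithin 0 (Set.Ioi 0)) Filter.atTop :=
        (Filter.tendsto_neg_atBot_atTop.comp hT0).const_mul_atTop (abs_pos.2 ha)
      obtain ⟨r, ⟨hr, hrM, hrT⟩, hlt⟩ :=
        (hnear.and (ht.eventually_gt_atTop (M + |h 1 - a * T 1|))).exists
      have e : a * T r = h r - (h 1 - a * T 1) := by rw [← h2 r hr]; ring
      have : |a| * -T r = |a * T r| := by rw [abs_mul, abs_of_nonpos hrT]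
      rw [this, e] at hlt
      linarith [abs_sub (h r) (h 1 - a * T 1)]
    refine ⟨h 1, fun r hr => ?_⟩
    have := h2 r hr
    rw [ha] at this
    simp at this
    simp [this]
  · obtain ⟨a, ha⟩ := eq_mul_exp_of_hasDerivAt (g := fun r => φ r * h' r + κ * h r) (κ := κ) hT
      (fun r hr => ((hflux r hr).add ((hh r hr).const_mul κ)).congr_deriv (by
        have := (hφ r hr).ne'
        field_simp
        ring))
    obtain ⟨b, hb⟩ := eq_mul_exp_of_hasDerivAt (g := fun r => φ r * h' r - κ * h r) (κ := -κ) hT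
      (fun r hr => ((hflux r hr).sub ((hh r hr).const_mul κ)).congr_deriv (by
        have := (hφ r hr).ne'
        field_simp
        ring))
    have hb0 : b = 0 := by
      by_contra hb0
      have ht : Filter.Tendsto (fun r => |b| * Real.exp (κ * -T r)) (nhdsWithin 0 (Set.Ioi 0))
          Filter.atTop :=
        (Real.tendsto_exp_atTop.comp ((Filter.tendsto_neg_atBot_atTop.comp hT0).const_mul_atTop
          hκ)).const_mul_atTop (abs_pos.2 hb0)
      obtain ⟨r, ⟨hr, hrM, hrT⟩, hlt⟩ :=
        (hnear.and (ht.eventually_gt_atTop (|a| + 2 * κ * M))).exists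
      have e : b * Real.exp (-κ * T r) = a * Real.exp (κ * T r) - 2 * κ * h r := by
        rw [← ha r hr, ← hb r hr]
        ring
      have e2 : |b| * Real.exp (κ * -T r) = |b * Real.exp (-κ * T r)| := by
        rw [abs_mul, Real.abs_exp, neg_mul, mul_neg]
      rw [e2, e] at hlt
      have h3 := abs_sub (a * Real.exp (κ * T r)) (2 * κ * h r)
      rw [abs_mul, abs_mul (2 * κ), Real.abs_exp, abs_of_pos (by linarith : 0 < 2 * κ)] at h3
      have h4 : Real.exp (κ * T r) ≤ 1 :=
        Real.exp_le_one_iff.2 (mul_nonpos_of_nonneg_of_nonpos hκ.le hrT)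
      have h5 := mul_le_mul_of_nonneg_left h4 (abs_nonneg a)
      have h6 := mul_le_mul_of_nonneg_left hrM (by linarith : 0 ≤ 2 * κ)
      linarith
    refine ⟨a / (2 * κ), fun r hr => ?_⟩
    have h1 := ha r hr
    have h2 := hb r hr
    simp only [hb0, zero_mul] at h1 h2
    field_simp
    linarith

/-- One-sided form of `eq_zero_of_bounded_of_mode_equation`. For `v = u exp (-κ T)` and
`p = φ exp (2 κ T)` the equation reads `(p v')' = c p`. Since `p' ≤ L r p`, a positive `c` forces
`v' ≥ δ / r` for large `r`, so that `v`, and with it `u`, grows at least like `log r`. -/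
theorem nonpos_of_bounded_of_mode_equation {φ φ' T u u' : ℝ → ℝ} {κ c A m B r₀ : ℝ} (hκ : 0 ≤ κ)
    (hm : 0 < m) (hr₀ : 0 < r₀) (hφm : ∀ r, r₀ ≤ r → m ≤ φ r)
    (hφ' : ∀ r, r₀ ≤ r → HasDerivAt φ (φ' r) r) (hA : ∀ r, r₀ ≤ r → φ' r ≤ A * r * φ r)
    (hT : ∀ r, r₀ ≤ r → HasDerivAt T (1 / φ r) r)
    (hu : ∀ r, r₀ ≤ r → HasDerivAt u (u' r) r)
    (hu' : ∀ r, r₀ ≤ r → HasDerivAt u'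
      (c * Real.exp (κ * T r) + κ ^ 2 / φ r ^ 2 * u r - φ' r / φ r * u' r) r)
    (hB : ∀ r, r₀ ≤ r → u r ≤ B) : c ≤ 0 := by
  by_contra! hc
  have hφ : ∀ r, r₀ ≤ r → 0 < φ r := fun r hr => hm.trans_le (hφm r hr)
  have hTmono : MonotoneOn T (Set.Ici r₀) :=
    monotoneOn_Ici_of_hasDerivAt hT fun x hx => (div_pos one_pos (hφ x hx)).le
  set p : ℝ → ℝ := fun r => φ r * Real.exp (2 * κ * T r) with hp
  set P : ℝ → ℝ := fun r => Real.exp (κ * T r) * (φ r * u' r - κ * u r) with hP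
  have hp' : ∀ r, r₀ ≤ r → HasDerivAt p ((φ' r + 2 * κ) * Real.exp (2 * κ * T r)) r := by
    intro r hr
    refine ((hφ' r hr).mul ((hT r hr).const_mul (2 * κ)).exp).congr_deriv ?_
    have := (hφ r hr).ne'
    field_simp
  have hP' : ∀ r, r₀ ≤ r → HasDerivAt P (c * p r) r := by
    intro r hr
    refine (((hT r hr).const_mul κ).exp.mul
      (((hφ' r hr).mul (hu' r hr)).sub ((hu r hr).const_mul κ))).congr_deriv ?_
    have := (hφ r hr).ne'
    have e : Real.exp (2 * κ * T r) = Real.exp (κ * T r) * Real.exp (κ * T r) := by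
      rw [← Real.exp_add]
      ring_nf
    simp only [hp, e]
    simp only [Pi.mul_apply, Pi.sub_apply]
    field_simp
    ring
  obtain ⟨L, hL, hpL⟩ : ∃ L : ℝ, 0 < L ∧ ∀ r, r₀ ≤ r →
      (φ' r + 2 * κ) * Real.exp (2 * κ * T r) ≤ L * r * p r := by
    refine ⟨|A| + 2 * κ / (m * r₀) + 1, by positivity, fun r hr => ?_⟩
    have hr0 : 0 < r := by linarith
    have h1 : 2 * κ ≤ 2 * κ / (m * r₀) * r * φ r := by
      have h2 : m * r₀ ≤ φ r * r := mul_le_mul (hφm r hr) hr hr₀.le (hφ r hr).le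
      have h3 := mul_le_mul_of_nonneg_left h2 (by positivity : 0 ≤ 2 * κ / (m * r₀))
      rw [div_mul_cancel₀ _ (by positivity)] at h3
      linarith
    have hrφ : 0 < r * φ r := mul_pos hr0 (hφ r hr)
    have h4 : φ' r + 2 * κ ≤ (|A| + 2 * κ / (m * r₀) + 1) * r * φ r := by
      nlinarith [hA r hr, mul_le_mul_of_nonneg_right (le_abs_self A) hrφ.le]
    have := mul_le_mul_of_nonneg_right h4 (Real.exp_pos (2 * κ * T r)).le
    simp only [hp]
    linarith
  set μ := m * Real.exp (2 * κ * T r₀) with hμ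
  have hμpos : 0 < μ := by positivity
  have hpμ : ∀ r, r₀ ≤ r → μ ≤ p r := fun r hr =>
    mul_le_mul (hφm r hr) (Real.exp_le_exp.2 (mul_le_mul_of_nonneg_left
      (hTmono (Set.mem_Ici.2 le_rfl) (Set.mem_Ici.2 hr) hr) (by positivity)))
      (Real.exp_pos _).le (hφ r hr).le
  set δ := c / (2 * L) with hδ
  have hδpos : 0 < δ := by positivity
  -- `P - δ p / r` has derivative at least `c p - δ L p = c p / 2 ≥ c μ / 2`, so it tends to infinity.
  have hmono := monotoneOn_Ici_of_hasDerivAt (a := r₀)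
    (f := fun r => P r - δ * (p r / r) - c / 2 * μ * r)
    (fun r hr => ((hP' r hr).sub (((hp' r hr).div (hasDerivAt_id r)
      (by simp only [id]; linarith)).const_mul δ)).sub ((hasDerivAt_id r).const_mul (c / 2 * μ)))
    (fun r hr => by
      have hr0 : 0 < r := by linarith
      have hp0 : 0 < p r := hμpos.trans_le (hpμ r hr)
      have h1 : δ * (((φ' r + 2 * κ) * Real.exp (2 * κ * T r) * r - p r * 1) / r ^ 2) ≤
          c / 2 * p r := by
        have h2 : ((φ' r + 2 * κ) * Real.exp (2 * κ * T r) * r - p r * 1) / r ^ 2 ≤ L * p r := by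
          rw [div_le_iff₀ (by positivity)]
          nlinarith [mul_le_mul_of_nonneg_right (hpL r hr) hr0.le]
        refine (mul_le_mul_of_nonneg_left h2 hδpos.le).trans_eq ?_
        rw [hδ]
        field_simp
      have h3 := mul_le_mul_of_nonneg_left (hpμ r hr) (by positivity : 0 ≤ c / 2)
      simp only [id]
      linarith)
  obtain ⟨r₁, h01, hr₁⟩ : ∃ r₁, r₀ ≤ r₁ ∧ ∀ r, r₁ ≤ r → δ * (p r / r) ≤ P r := by
    set X := P r₀ - δ * (p r₀ / r₀) - c / 2 * μ * r₀ with hX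
    refine ⟨max r₀ (|X| / (c / 2 * μ)), le_max_left _ _, fun r hr => ?_⟩
    have h1 := hmono (Set.mem_Ici.2 le_rfl) (Set.mem_Ici.2 ((le_max_left _ _).trans hr))
      ((le_max_left _ _).trans hr)
    have h2 := (div_le_iff₀ (by positivity : 0 < c / 2 * μ)).1 ((le_max_right _ _).trans hr)
    simp only [← hX] at h1
    linarith [neg_abs_le X]
  have hv : ∀ r, r₀ ≤ r → HasDerivAt (fun r => u r * Real.exp (-(κ * T r))) (P r / p r) r := by
    intro r hr
    refine ((hu r hr).mul ((hT r hr).const_mul κ).neg.exp).congr_deriv ?_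
    have := (hφ r hr).ne'
    have e : Real.exp (2 * κ * T r) = Real.exp (κ * T r) * Real.exp (κ * T r) := by
      rw [← Real.exp_add]
      ring_nf
    simp only [hP, hp, e, Pi.neg_apply, Real.exp_neg]
    field_simp
    ring
  have hvmono := monotoneOn_Ici_of_hasDerivAt (a := r₁)
    (f := fun r => u r * Real.exp (-(κ * T r)) - δ * Real.log r)
    (fun r hr => (hv r (h01.trans hr)).sub
      ((Real.hasDerivAt_log (by linarith : r ≠ 0)).const_mul δ))
    (fun r hr => by
      have hr0 : 0 < r := by linarith
      have hp0 : 0 < p r := hμpos.trans_le (hpμ r (h01.trans hr))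
      have h1 : δ * r⁻¹ ≤ P r / p r := by
        rw [le_div_iff₀ hp0]
        refine le_trans (le_of_eq ?_) (hr₁ r hr)
        ring
      linarith)
  set Y := u r₁ * Real.exp (-(κ * T r₁)) - δ * Real.log r₁
  have ht : Filter.Tendsto (fun r => Y + δ * Real.log r) Filter.atTop Filter.atTop :=
    Filter.tendsto_atTop_add_const_left _ _ (Real.tendsto_log_atTop.const_mul_atTop hδpos)
  obtain ⟨r, hr, hlt⟩ := ((Filter.eventually_ge_atTop r₁).and
    (ht.eventually_gt_atTop (|B| * Real.exp (-(κ * T r₀))))).exists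
  have h1 := hvmono (Set.mem_Ici.2 le_rfl) (Set.mem_Ici.2 hr) hr
  have h2 : u r * Real.exp (-(κ * T r)) ≤ |B| * Real.exp (-(κ * T r₀)) :=
    mul_le_mul ((hB r (h01.trans hr)).trans (le_abs_self B))
      (Real.exp_le_exp.2 (neg_le_neg (mul_le_mul_of_nonneg_left
        (hTmono (Set.mem_Ici.2 le_rfl) (Set.mem_Ici.2 (h01.trans hr)) (h01.trans hr)) hκ)))
      (Real.exp_pos _).le (abs_nonneg B)
  simp only at h1
  linarith

/-- If the Fourier mode of frequency `κ` of the Laplacian of `u` is `c exp (κ T)` and the mode of `u`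
is bounded, then `c = 0`, provided that `φ' / φ` grows at most linearly. -/
theorem eq_zero_of_bounded_of_mode_equation {φ φ' T u u' : ℝ → ℝ} {κ c A m B r₀ : ℝ} (hκ : 0 ≤ κ)
    (hm : 0 < m) (hr₀ : 0 < r₀) (hφm : ∀ r, r₀ ≤ r → m ≤ φ r)
    (hφ' : ∀ r, r₀ ≤ r → HasDerivAt φ (φ' r) r) (hA : ∀ r, r₀ ≤ r → φ' r ≤ A * r * φ r)
    (hT : ∀ r, r₀ ≤ r → HasDerivAt T (1 / φ r) r)
    (hu : ∀ r, r₀ ≤ r → HasDerivAt u (u' r) r)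
    (hu' : ∀ r, r₀ ≤ r → HasDerivAt u'
      (c * Real.exp (κ * T r) + κ ^ 2 / φ r ^ 2 * u r - φ' r / φ r * u' r) r)
    (hB : ∀ r, r₀ ≤ r → |u r| ≤ B) : c = 0 := by
  refine le_antisymm (nonpos_of_bounded_of_mode_equation hκ hm hr₀ hφm hφ' hA hT hu hu'
    fun r hr => (le_abs_self _).trans (hB r hr)) (neg_nonpos.1 ?_)
  refine nonpos_of_bounded_of_mode_equation (u := fun r => -u r) (u' := fun r => -u' r)
    hκ hm hr₀ hφm hφ' hA hT (fun r hr => (hu r hr).neg)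
    (fun r hr => (hu' r hr).neg.congr_deriv (by ring))
    fun r hr => (neg_le_abs _).trans (hB r hr)

/-- If `φ'' ≤ η r² φ`, then the logarithmic derivative of `φ` grows at most linearly. -/
theorem exists_deriv_le_mul_of_second_deriv_le {φ φ' φ'' : ℝ → ℝ} {η r₀ : ℝ} (hr₀ : 0 < r₀)
    (h0 : ∀ r, r₀ ≤ r → 0 < φ r) (h1 : ∀ r, r₀ ≤ r → HasDerivAt φ (φ' r) r)
    (h2 : ∀ r, r₀ ≤ r → HasDerivAt φ' (φ'' r) r)
    (hcurv : ∀ r, r₀ ≤ r → φ'' r ≤ η * r ^ 2 * φ r) :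
    ∃ A : ℝ, ∀ r, r₀ ≤ r → φ' r ≤ A * r * φ r := by
  have hp := h0 r₀ le_rfl
  obtain ⟨A, hA1, hAη, hA0⟩ : ∃ A : ℝ, 1 ≤ A ∧ η ≤ A ∧ φ' r₀ / (r₀ * φ r₀) ≤ A :=
    ⟨max 1 (max η (φ' r₀ / (r₀ * φ r₀))), by simp, by simp, by simp⟩
  refine ⟨A, fun r hr => ?_⟩
  -- As `A² ≥ η`, the function `z = A r φ - φ'` satisfies `z' ≥ -A r z`, and `z r₀ ≥ 0`.
  have hm := monotoneOn_Ici_of_hasDerivAt (a := r₀)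
    (f := fun r => (A * r * φ r - φ' r) * Real.exp (A / 2 * r ^ 2))
    (f' := fun r => (A * φ r + A ^ 2 * r ^ 2 * φ r - φ'' r) * Real.exp (A / 2 * r ^ 2))
    (fun x hx => ((((((hasDerivAt_id x).const_mul A).mul (h1 x hx)).sub (h2 x hx)).mul
      (((hasDerivAt_pow 2 x).const_mul (A / 2)).exp)).congr_deriv (by
        simp only [Pi.mul_apply, Pi.sub_apply, id]
        norm_num
        ring)))
    (fun x hx => by
      refine mul_nonneg ?_ (Real.exp_pos _).le
      have hφx := h0 x hx
      have h3 : η ≤ A ^ 2 := by nlinarith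
      have h4 := mul_le_mul_of_nonneg_right h3 (by positivity : 0 ≤ x ^ 2 * φ x)
      have h5 : 0 ≤ A * φ x := by positivity
      nlinarith [hcurv x hx])
  have h3 := hm (Set.mem_Ici.2 le_rfl) (Set.mem_Ici.2 hr) hr
  rw [div_le_iff₀ (by positivity)] at hA0
  have h4 : 0 ≤ A * r₀ * φ r₀ - φ' r₀ := by linarith
  have h5 := nonneg_of_mul_nonneg_left ((mul_nonneg h4 (Real.exp_pos _).le).trans h3)
    (Real.exp_pos _)
  linarith

namespace RotSurface

/-- The primitive `T` of `1 / φ`, for which `exp (T + i θ)` is a conformal coordinate of the surface.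
It is `log r` up to a smooth function. -/
theorem IsSmoothProfile.exists_conformal_coordinate {φ : ℝ → ℝ} (h : IsSmoothProfile φ) :
    ∃ T : ℝ → ℝ, (∀ r, 0 < r → HasDerivAt T (1 / φ r) r) ∧
      Filter.Tendsto T (nhdsWithin 0 (Set.Ioi 0)) Filter.atBot := by
  obtain ⟨a, ha, haev, hapos, hφ, β, hβ, hβev, haβ⟩ := h.exists_even_factor
  obtain ⟨c, hc, -, hd⟩ := exists_contDiff_even_hasDerivAt_sq_mul (a := fun r => β r / a r)
    (hβ.div ha fun r => (hapos r).ne') (fun r => by simp only [hβev r, haev r])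
  refine ⟨fun r => Real.log r - r ^ 2 * c r, fun r hr => ?_, ?_⟩
  · refine ((Real.hasDerivAt_log hr.ne').sub (hd r)).congr_deriv ?_
    have := (hapos r).ne'
    rw [hφ r hr.le]
    field_simp
    rw [haβ r]
    ring
  · have h1 : Filter.Tendsto (fun r : ℝ => -(r ^ 2 * c r)) (nhdsWithin 0 (Set.Ioi 0))
        (nhds (-(0 ^ 2 * c 0))) :=
      (Continuous.tendsto (by have := hc.continuous; fun_prop) 0).mono_left nhdsWithin_le_nhds
    simpa only [sub_eq_add_neg] using Real.tendsto_log_nhdsGT_zero.atBot_add h1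

end RotSurface

/-! ### Completeness of the trigonometric functions -/

/-- A continuous `2π`-periodic function with vanishing Fourier coefficients is zero: its Fourier series
is summable, hence converges to it. -/
theorem eq_zero_of_forall_integral_mul_cos_eq_zero {f : ℝ → ℝ} (hc : Continuous f)
    (hp : Function.Periodic f (2 * Real.pi))
    (h0 : ∀ (n : ℤ) (α : ℝ), ∫ θ in (0 : ℝ)..2 * Real.pi, f θ * Real.cos (n * θ + α) = 0) (θ : ℝ) :
    f θ = 0 := by
  have : Fact (0 < 2 * Real.pi) := ⟨Real.two_pi_pos⟩
  have hpc : Function.Periodic (fun x => (f x : ℂ)) (2 * Real.pi) := fun x => by simp only [hp x]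
  let F : C(AddCircle (2 * Real.pi), ℂ) :=
    ⟨hpc.lift, continuous_coinduced_dom.2 (Complex.continuous_ofReal.comp hc)⟩
  have hF : ∀ x : ℝ, F (x : AddCircle (2 * Real.pi)) = (f x : ℂ) := fun x => rfl
  -- The phases `0` and `π / 2` give the real and the imaginary part of `exp (-i n x)`.
  have hcoeff : ∀ n : ℤ, fourierCoeff F n = 0 := by
    intro n
    rw [fourierCoeff_eq_intervalIntegral _ _ 0, zero_add]
    have e : ∀ x : ℝ, fourier (-n) (x : AddCircle (2 * Real.pi)) •
        F (x : AddCircle (2 * Real.pi)) =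
        ((f x * Real.cos (n * x + 0) : ℝ) : ℂ) +
          Complex.I * ((f x * Real.cos (n * x + Real.pi / 2) : ℝ) : ℂ) := by
      intro x
      rw [hF, fourier_coe_apply]
      have : 2 * (Real.pi : ℂ) * Complex.I * ((-n : ℤ) : ℂ) * (x : ℂ) / ((2 * Real.pi : ℝ) : ℂ) =
          ((-(n * x) : ℝ) : ℂ) * Complex.I := by
        have hpi : (Real.pi : ℂ) ≠ 0 := by exact_mod_cast Real.pi_ne_zero
        push_cast
        field_simp
      rw [this, Complex.exp_mul_I, ← Complex.ofReal_cos, ← Complex.ofReal_sin, Real.cos_neg,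
        Real.sin_neg, Real.cos_add_pi_div_two, add_zero, smul_eq_mul]
      push_cast
      ring
    simp_rw [e]
    have hi : ∀ α : ℝ, IntervalIntegrable
        (fun x => ((f x * Real.cos (n * x + α) : ℝ) : ℂ)) MeasureTheory.volume 0 (2 * Real.pi) :=
      fun α => (by fun_prop : Continuous fun x =>
        ((f x * Real.cos (n * x + α) : ℝ) : ℂ)).intervalIntegrable _ _
    rw [intervalIntegral.integral_add (hi 0) ((hi _).const_mul _),
      intervalIntegral.integral_const_mul, intervalIntegral.integral_ofReal,
      intervalIntegral.integral_ofReal, h0, h0]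
    simp
  have hsum := has_pointwise_sum_fourier_series_of_summable (f := F)
    (by simpa only [funext hcoeff] using summable_zero) (θ : AddCircle (2 * Real.pi))
  simp only [hcoeff, zero_smul] at hsum
  have := hsum.unique hasSum_zero
  rw [hF] at this
  exact_mod_cast this

namespace RotSurface

/-! ### Partial derivatives on the half-plane of polar coordinates -/

/-- The domain `r > 0` of polar coordinates `(r, θ)`. -/
def polarDomain : Set (ℝ × ℝ) := Set.Ioi 0 ×ˢ Set.univ

theorem isOpen_polarDomain : IsOpen polarDomain := isOpen_Ioi.prod isOpen_univ

theorem mem_polarDomain {r : ℝ} (hr : 0 < r) (θ : ℝ) : (r, θ) ∈ polarDomain := ⟨hr, trivial⟩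

section

variable {V : ℝ → ℝ → ℝ} {n : ℕ}

theorem hasFDerivAt_uncurry (hV : ContDiffOn ℝ (n + 1) (Function.uncurry V) polarDomain)
    {p : ℝ × ℝ} (hp : p ∈ polarDomain) :
    HasFDerivAt (Function.uncurry V) (fderiv ℝ (Function.uncurry V) p) p :=
  ((hV.differentiableOn (by simp)).differentiableAt (isOpen_polarDomain.mem_nhds hp)).hasFDerivAt

theorem hasDerivAt_fst (hV : ContDiffOn ℝ (n + 1) (Function.uncurry V) polarDomain)
    {r : ℝ} (hr : 0 < r) (θ : ℝ) : HasDerivAt (fun s => V s θ) (pd1 V r θ) r := by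
  have := (hasFDerivAt_uncurry hV (mem_polarDomain hr θ)).comp_hasDerivAt (f := fun s => (s, θ)) r
    ((hasDerivAt_id r).prodMk (hasDerivAt_const r θ))
  exact (DifferentiableAt.hasDerivAt this.differentiableAt)

theorem hasDerivAt_snd (hV : ContDiffOn ℝ (n + 1) (Function.uncurry V) polarDomain)
    {r : ℝ} (hr : 0 < r) (θ : ℝ) : HasDerivAt (V r) (pd2 V r θ) θ := by
  have := (hasFDerivAt_uncurry hV (mem_polarDomain hr θ)).comp_hasDerivAt (f := fun t => (r, t)) θ
    ((hasDerivAt_const θ r).prodMk (hasDerivAt_id θ))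
  exact (DifferentiableAt.hasDerivAt this.differentiableAt)

theorem contDiffOn_pd1 (hV : ContDiffOn ℝ (n + 1) (Function.uncurry V) polarDomain) :
    ContDiffOn ℝ n (Function.uncurry (pd1 V)) polarDomain := by
  refine ((hV.fderiv_of_isOpen isOpen_polarDomain le_rfl).clm_apply
    (contDiffOn_const (c := ((1 : ℝ), (0 : ℝ))))).congr ?_
  rintro ⟨r, θ⟩ hp
  exact ((hasFDerivAt_uncurry hV hp).comp_hasDerivAt (f := fun s => (s, θ)) r
    ((hasDerivAt_id r).prodMk (hasDerivAt_const r θ))).deriv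

theorem contDiffOn_pd2 (hV : ContDiffOn ℝ (n + 1) (Function.uncurry V) polarDomain) :
    ContDiffOn ℝ n (Function.uncurry (pd2 V)) polarDomain := by
  refine ((hV.fderiv_of_isOpen isOpen_polarDomain le_rfl).clm_apply
    (contDiffOn_const (c := ((0 : ℝ), (1 : ℝ))))).congr ?_
  rintro ⟨r, θ⟩ hp
  exact ((hasFDerivAt_uncurry hV hp).comp_hasDerivAt (f := fun t => (r, t)) θ
    ((hasDerivAt_const θ r).prodMk (hasDerivAt_id θ))).deriv

theorem continuous_of_contDiffOn {m : ℕ} (hV : ContDiffOn ℝ m (Function.uncurry V) polarDomain)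
    {r : ℝ} (hr : 0 < r) : Continuous (V r) := by
  rw [← continuousOn_univ]
  exact hV.continuousOn.comp (f := fun t => (r, t)) (by fun_prop) fun t _ => mem_polarDomain hr t

theorem lap_eq_of_contDiffOn {φ : ℝ → ℝ} (h : IsSmoothProfile φ)
    (hV : ContDiffOn ℝ (n + 2) (Function.uncurry V) polarDomain) {r : ℝ} (hr : 0 < r) (θ : ℝ) :
    lap φ V r θ = pd1 (pd1 V) r θ + deriv φ r / φ r * pd1 V r θ +
      1 / φ r ^ 2 * pd2 (pd2 V) r θ :=
  lap_eq h hr θ (hasDerivAt_fst (n := n) (contDiffOn_pd1 (n := n + 1)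
    (by push_cast; rwa [add_assoc, one_add_one_eq_two])) hr θ).differentiableAt

theorem contDiffOn_lap {φ : ℝ → ℝ} (h : IsSmoothProfile φ)
    (hV : ContDiffOn ℝ (n + 2) (Function.uncurry V) polarDomain) :
    ContDiffOn ℝ n (Function.uncurry (lap φ V)) polarDomain := by
  have hV' : ContDiffOn ℝ ((n + 1 : ℕ) + 1) (Function.uncurry V) polarDomain := by
    push_cast
    rwa [add_assoc, one_add_one_eq_two]
  have h1 := contDiffOn_pd1 hV'
  have h2 := contDiffOn_pd2 hV'
  push_cast at h1 h2
  have hfst : Set.MapsTo Prod.fst polarDomain (Set.Ioi 0) := fun p hp => hp.1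
  have hφ : ContDiffOn ℝ n (fun p : ℝ × ℝ => φ p.1) polarDomain :=
    ContDiffOn.comp (g := φ) (fun r hr => ((h.contDiffAt hr).of_le
      (by exact_mod_cast le_top)).contDiffWithinAt) contDiffOn_fst hfst
  have hφ' : ContDiffOn ℝ n (fun p : ℝ × ℝ => deriv φ p.1) polarDomain :=
    ContDiffOn.comp (g := deriv φ) (fun r hr => (((h.contDiffAt hr).derivWithin (m := ∞)
      (by simp)).of_le (by exact_mod_cast le_top)).contDiffWithinAt) contDiffOn_fst hfst
  have hne : ∀ p ∈ polarDomain, φ p.1 ≠ 0 := fun p hp => (h.pos p.1 hp.1).ne'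
  refine (((contDiffOn_pd1 h1).add ((hφ'.div hφ hne).mul (h1.of_le (by simp)))).add
    (((contDiffOn_const (c := (1 : ℝ))).div (hφ.pow 2) fun p hp => pow_ne_zero 2 (hne p hp)).mul
      (contDiffOn_pd2 h2))).congr ?_
  rintro ⟨r, θ⟩ hp
  exact lap_eq_of_contDiffOn h hV hp.1 θ

theorem pd2_periodic {T : ℝ} {r : ℝ} (hp : Function.Periodic (V r) T) :
    Function.Periodic (pd2 V r) T := by
  intro θ
  have := deriv_comp_add_const (V r) T θ
  rw [funext fun t => hp t] at this
  exact this.symm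

theorem lap_periodic {φ : ℝ → ℝ} (h : IsSmoothProfile φ) {T : ℝ}
    (hV : ContDiffOn ℝ (n + 2) (Function.uncurry V) polarDomain)
    (hp : ∀ r, Function.Periodic (V r) T) {r : ℝ} (hr : 0 < r) :
    Function.Periodic (lap φ V r) T := by
  intro θ
  have h1 : ∀ s t, pd1 V s (t + T) = pd1 V s t := fun s t => by simp only [pd1, hp _ t]
  have h2 : pd1 (pd1 V) r (θ + T) = pd1 (pd1 V) r θ := by
    rw [pd1, pd1]
    simp only [h1]
  rw [lap_eq_of_contDiffOn h hV hr, lap_eq_of_contDiffOn h hV hr, h1, h2,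
    pd2_periodic (pd2_periodic (hp r)) θ]

end

/-! ### Fourier modes -/

/-- The Fourier mode `r ↦ ∫₀^{2π} V(r, θ) cos (n θ + α) dθ`. The phases `α = 0` and `α = π / 2`
give the cosine and the sine coefficients. -/
noncomputable def mode (n : ℤ) (α : ℝ) (V : ℝ → ℝ → ℝ) (r : ℝ) : ℝ :=
  ∫ θ in (0 : ℝ)..2 * Real.pi, V r θ * Real.cos (n * θ + α)

theorem hasDerivAt_mode {V : ℝ → ℝ → ℝ} {m : ℕ} (n : ℤ) (α : ℝ)
    (hV : ContDiffOn ℝ (m + 1) (Function.uncurry V) polarDomain) {r : ℝ} (hr : 0 < r) :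
    HasDerivAt (mode n α V) (mode n α (pd1 V) r) r := by
  have hcos : ContinuousOn (fun p : ℝ × ℝ => Real.cos (n * p.2 + α)) polarDomain := by fun_prop
  exact hasDerivAt_intervalIntegral_of_continuousOn
    (F := fun r θ => V r θ * Real.cos (n * θ + α))
    (F' := fun r θ => pd1 V r θ * Real.cos (n * θ + α)) isOpen_Ioi 0 (2 * Real.pi)
    (hV.continuousOn.mul hcos) ((contDiffOn_pd1 hV).continuousOn.mul hcos)
    (fun r hr t => (hasDerivAt_fst hV hr t).mul_const _) hr

theorem mode_pd2_pd2 {V : ℝ → ℝ → ℝ} {m : ℕ} (n : ℤ) (α : ℝ)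
    (hV : ContDiffOn ℝ (m + 2) (Function.uncurry V) polarDomain)
    {r : ℝ} (hr : 0 < r) (hp : Function.Periodic (V r) (2 * Real.pi)) :
    mode n α (pd2 (pd2 V)) r = -(n : ℝ) ^ 2 * mode n α V r := by
  have hV' : ContDiffOn ℝ ((m + 1 : ℕ) + 1) (Function.uncurry V) polarDomain := by
    push_cast
    rwa [add_assoc, one_add_one_eq_two]
  have hV2 := contDiffOn_pd2 hV'
  push_cast at hV2
  have hc0 := continuous_of_contDiffOn (m := m + 2) (by exact_mod_cast hV) hr
  have hc2 := continuous_of_contDiffOn (contDiffOn_pd2 hV2) hr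
  have hlin : ∀ θ : ℝ, HasDerivAt (fun t : ℝ => n * t + α) n θ := fun θ => by
    simpa using ((hasDerivAt_id θ).const_mul (n : ℝ)).add_const α
  have hd : ∀ θ, HasDerivAt
      (fun t => pd2 V r t * Real.cos (n * t + α) + V r t * (n * Real.sin (n * t + α)))
      (pd2 (pd2 V) r θ * Real.cos (n * θ + α) + (n : ℝ) ^ 2 * (V r θ * Real.cos (n * θ + α))) θ := by
    intro θ
    refine (((hasDerivAt_snd hV2 hr θ).mul (hlin θ).cos).add
      ((hasDerivAt_snd hV' hr θ).mul ((hlin θ).sin.const_mul (n : ℝ)))).congr_deriv ?_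
    ring
  have hi1 : Continuous fun θ => pd2 (pd2 V) r θ * Real.cos (n * θ + α) := by fun_prop
  have hi2 : Continuous fun θ => (n : ℝ) ^ 2 * (V r θ * Real.cos (n * θ + α)) := by fun_prop
  have := intervalIntegral.integral_eq_sub_of_hasDerivAt (a := 0) (b := 2 * Real.pi)
    (fun θ _ => hd θ) ((hi1.add hi2).intervalIntegrable _ _)
  rw [intervalIntegral.integral_add (hi1.intervalIntegrable _ _) (hi2.intervalIntegrable _ _),
    intervalIntegral.integral_const_mul] at this
  have e1 : (n : ℝ) * (2 * Real.pi) + α = α + n * (2 * Real.pi) := by ring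
  have e2 : pd2 V r (2 * Real.pi) = pd2 V r 0 := by simpa using pd2_periodic hp 0
  have e3 : V r (2 * Real.pi) = V r 0 := by simpa using hp 0
  rw [e1, Real.cos_add_int_mul_two_pi, Real.sin_add_int_mul_two_pi, e2, e3, mul_zero, zero_add,
    sub_self] at this
  simp only [mode]
  linarith

/-- The Fourier modes of `ΔV`: the angular derivatives become multiplication by `-n²`. -/
theorem mode_lap {φ : ℝ → ℝ} (h : IsSmoothProfile φ) {V : ℝ → ℝ → ℝ} {m : ℕ} (n : ℤ) (α : ℝ)
    (hV : ContDiffOn ℝ (m + 2) (Function.uncurry V) polarDomain)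
    {r : ℝ} (hr : 0 < r) (hp : Function.Periodic (V r) (2 * Real.pi)) :
    mode n α (lap φ V) r = mode n α (pd1 (pd1 V)) r + deriv φ r / φ r * mode n α (pd1 V) r -
      (n : ℝ) ^ 2 / φ r ^ 2 * mode n α V r := by
  have hV' : ContDiffOn ℝ ((m + 1 : ℕ) + 1) (Function.uncurry V) polarDomain := by
    push_cast
    rwa [add_assoc, one_add_one_eq_two]
  have hV1 := contDiffOn_pd1 hV'
  have hV2 := contDiffOn_pd2 hV'
  push_cast at hV1 hV2
  have hc1 := continuous_of_contDiffOn (m := m + 1) (by exact_mod_cast hV1) hr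
  have hc11 := continuous_of_contDiffOn (contDiffOn_pd1 hV1) hr
  have hc22 := continuous_of_contDiffOn (contDiffOn_pd2 hV2) hr
  have e : ∀ θ, lap φ V r θ * Real.cos (n * θ + α) =
      pd1 (pd1 V) r θ * Real.cos (n * θ + α) +
        deriv φ r / φ r * (pd1 V r θ * Real.cos (n * θ + α)) +
        1 / φ r ^ 2 * (pd2 (pd2 V) r θ * Real.cos (n * θ + α)) := by
    intro θ
    rw [lap_eq_of_contDiffOn h hV hr]
    ring
  have i1 : Continuous fun θ => pd1 (pd1 V) r θ * Real.cos (n * θ + α) := by fun_prop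
  have i2 : Continuous fun θ => deriv φ r / φ r * (pd1 V r θ * Real.cos (n * θ + α)) := by fun_prop
  have i3 : Continuous fun θ => 1 / φ r ^ 2 * (pd2 (pd2 V) r θ * Real.cos (n * θ + α)) := by
    fun_prop
  have e3 := mode_pd2_pd2 n α hV hr hp
  simp only [mode] at e3
  simp only [mode, e]
  have i12 : Continuous fun θ => pd1 (pd1 V) r θ * Real.cos (n * θ + α) +
      deriv φ r / φ r * (pd1 V r θ * Real.cos (n * θ + α)) := i1.add i2
  rw [intervalIntegral.integral_add (i12.intervalIntegrable _ _)
    (i3.intervalIntegrable _ _), intervalIntegral.integral_add (i1.intervalIntegrable _ _)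
    (i2.intervalIntegrable _ _), intervalIntegral.integral_const_mul,
    intervalIntegral.integral_const_mul, e3]
  ring

theorem abs_mode_le {V : ℝ → ℝ → ℝ} (n : ℤ) (α : ℝ) {r M : ℝ} (hM : ∀ θ, |V r θ| ≤ M) :
    |mode n α V r| ≤ M * (2 * Real.pi) := by
  have := intervalIntegral.norm_integral_le_of_norm_le_const (a := 0) (b := 2 * Real.pi) (C := M)
    (f := fun θ => V r θ * Real.cos (n * θ + α)) (fun θ _ => by
      rw [Real.norm_eq_abs, abs_mul]
      calc |V r θ| * |Real.cos (n * θ + α)| ≤ |V r θ| * 1 :=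
            mul_le_mul_of_nonneg_left (Real.abs_cos_le_one _) (abs_nonneg _)
        _ ≤ M := by rw [mul_one]; exact hM θ)
  rwa [sub_zero, abs_of_pos Real.two_pi_pos] at this

/-! ### The Laplacian of a smooth function near the origin -/

theorem polarPt_eq_smul (r θ : ℝ) : polarPt r θ = r • polarPt 1 θ := by
  ext i
  fin_cases i <;> simp [polarPt]

theorem contDiff_polarPt : ContDiff ℝ ∞ fun p : ℝ × ℝ => polarPt p.1 p.2 := by
  rw [contDiff_euclidean]
  intro i
  fin_cases i
  · exact contDiff_fst.mul (Real.contDiff_cos.comp contDiff_snd)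
  · exact contDiff_fst.mul (Real.contDiff_sin.comp contDiff_snd)

theorem hasDerivAt_polarPt_fst (r θ : ℝ) :
    HasDerivAt (fun s => polarPt s θ) (polarPt 1 θ) r := by
  have := (hasDerivAt_id r).smul_const (polarPt 1 θ)
  rw [one_smul] at this
  exact this.congr_of_eventuallyEq (Filter.Eventually.of_forall fun s => polarPt_eq_smul s θ)

theorem hasDerivAt_polarPt_snd (r θ : ℝ) :
    HasDerivAt (polarPt r) (polarPt r (θ + Real.pi / 2)) θ := by
  have e : ∀ t, polarPt r t = Real.cos t • polarPt r 0 + Real.sin t • polarPt r (Real.pi / 2) := by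
    intro t
    ext i
    fin_cases i <;> simp [polarPt, mul_comm]
  have h := ((Real.hasDerivAt_cos θ).smul_const (polarPt r 0)).add
    ((Real.hasDerivAt_sin θ).smul_const (polarPt r (Real.pi / 2)))
  rw [e (θ + Real.pi / 2), Real.cos_add_pi_div_two, Real.sin_add_pi_div_two]
  exact h.congr_of_eventuallyEq (Filter.Eventually.of_forall e)

theorem polarPt_add_pi (r θ : ℝ) : polarPt r (θ + Real.pi / 2 + Real.pi / 2) = -polarPt r θ := by
  rw [show θ + Real.pi / 2 + Real.pi / 2 = θ + Real.pi by ring]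
  ext i
  fin_cases i <;> simp [polarPt]

theorem inPolar_periodic (u : Plane → ℝ) (r : ℝ) :
    Function.Periodic (inPolar u r) (2 * Real.pi) := fun θ => by simp [inPolar, polarPt]

theorem contDiffOn_inPolar {u : Plane → ℝ} {n : ℕ} (hu : ContDiff ℝ n u) :
    ContDiffOn ℝ n (Function.uncurry (inPolar u)) polarDomain :=
  (hu.comp (contDiff_infty.1 contDiff_polarPt n)).contDiffOn

/-- The Laplacian of `u` through the Euclidean derivatives of `u` in the radial and the angular
direction, with coefficients that stay bounded at the origin. -/
theorem lap_inPolar_eq {φ : ℝ → ℝ} (h : IsSmoothProfile φ) {u : Plane → ℝ} (hu : ContDiff ℝ 2 u)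
    {r : ℝ} (hr : 0 < r) (θ : ℝ) :
    lap φ (inPolar u) r θ =
      fderiv ℝ (fderiv ℝ u) (polarPt r θ) (polarPt 1 θ) (polarPt 1 θ) +
      (deriv φ r / φ r - r / φ r ^ 2) * fderiv ℝ u (polarPt r θ) (polarPt 1 θ) +
      (r / φ r) ^ 2 * fderiv ℝ (fderiv ℝ u) (polarPt r θ) (polarPt 1 (θ + Real.pi / 2))
        (polarPt 1 (θ + Real.pi / 2)) := by
  have hd1 : ∀ x, HasFDerivAt u (fderiv ℝ u x) x := fun x =>
    (hu.differentiable (by simp) x).hasFDerivAt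
  have hd2 : ∀ x, HasFDerivAt (fderiv ℝ u) (fderiv ℝ (fderiv ℝ u) x) x := fun x =>
    ((hu.fderiv_right (m := 1) (by norm_num)).differentiable (by simp) x).hasFDerivAt
  have e1 : ∀ s t, pd1 (inPolar u) s t = fderiv ℝ u (polarPt s t) (polarPt 1 t) := fun s t =>
    ((hd1 _).comp_hasDerivAt s (hasDerivAt_polarPt_fst s t)).deriv
  have e2 : ∀ s t, pd2 (inPolar u) s t =
      fderiv ℝ u (polarPt s t) (polarPt s (t + Real.pi / 2)) := fun s t =>
    ((hd1 _).comp_hasDerivAt t (hasDerivAt_polarPt_snd s t)).deriv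
  have e11 : pd1 (pd1 (inPolar u)) r θ =
      fderiv ℝ (fderiv ℝ u) (polarPt r θ) (polarPt 1 θ) (polarPt 1 θ) := by
    rw [pd1]
    simp only [e1]
    exact (((hd2 _).comp_hasDerivAt r (hasDerivAt_polarPt_fst r θ)).clm_apply
      (hasDerivAt_const r (polarPt 1 θ))).deriv.trans (by simp)
  have e22 : pd2 (pd2 (inPolar u)) r θ =
      r ^ 2 * fderiv ℝ (fderiv ℝ u) (polarPt r θ) (polarPt 1 (θ + Real.pi / 2))
        (polarPt 1 (θ + Real.pi / 2)) - r * fderiv ℝ u (polarPt r θ) (polarPt 1 θ) := by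
    rw [pd2]
    simp only [e2]
    have h1 : HasDerivAt (fun t => polarPt r (t + Real.pi / 2)) (-polarPt r θ) θ := by
      have := (hasDerivAt_polarPt_snd r (θ + Real.pi / 2)).comp_add_const θ (Real.pi / 2)
      rwa [polarPt_add_pi] at this
    refine (((hd2 _).comp_hasDerivAt θ (hasDerivAt_polarPt_snd r θ)).clm_apply h1).deriv.trans ?_
    rw [polarPt_eq_smul r (θ + Real.pi / 2)]
    simp only [Function.comp_apply, map_smul, map_neg, smul_apply, smul_eq_mul]
    rw [polarPt_eq_smul r θ]
    simp only [map_smul, smul_eq_mul]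
    ring
  have hdiff : DifferentiableAt ℝ (fun s => pd1 (inPolar u) s θ) r := by
    simp only [e1]
    exact (((hd2 _).comp_hasDerivAt r (hasDerivAt_polarPt_fst r θ)).clm_apply
      (hasDerivAt_const r (polarPt 1 θ))).differentiableAt
  rw [lap_eq h hr θ hdiff, e11, e22, e1]
  have := (h.pos r hr).ne'
  field_simp
  ring

/-- The coefficients of `lap_inPolar_eq` are bounded near the origin; each of the two terms of the first
one alone is of order `1 / r`. -/
theorem IsSmoothProfile.exists_coeff_bound {φ : ℝ → ℝ} (h : IsSmoothProfile φ) :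
    ∃ M : ℝ, ∀ r, 0 < r → r ≤ 1 →
      |deriv φ r / φ r - r / φ r ^ 2| ≤ M ∧ (r / φ r) ^ 2 ≤ M := by
  obtain ⟨a, ha, -, hapos, hφ, β, hβ, -, haβ⟩ := h.exists_even_factor
  have ha' : Continuous (deriv a) := ha.continuous_deriv (by simp)
  have hac := ha.continuous
  have hβc := hβ.continuous
  have hane : ∀ r, a r ≠ 0 := fun r => (hapos r).ne'
  obtain ⟨M₁, hM₁⟩ := (isCompact_Icc (a := (0 : ℝ)) (b := 1)).exists_bound_of_continuousOn
    (f := fun r => (r * β r * (a r + 1) + a r * deriv a r) / a r ^ 2)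
    (Continuous.continuousOn (by fun_prop (disch := simp [hane])))
  obtain ⟨M₂, hM₂⟩ := (isCompact_Icc (a := (0 : ℝ)) (b := 1)).exists_bound_of_continuousOn
    (f := fun r => (1 / a r) ^ 2) (Continuous.continuousOn (by fun_prop (disch := simp [hane])))
  refine ⟨max M₁ M₂, fun r hr hr1 => ⟨?_, ?_⟩⟩
  · refine le_trans (le_of_eq ?_) ((hM₁ r ⟨hr.le, hr1⟩).trans (le_max_left _ _))
    have hd : deriv φ r = a r + r * deriv a r := by
      have e : φ =ᶠ[nhds r] fun s => s * a s := by
        filter_upwards [Ioi_mem_nhds hr] with s hs using hφ s (le_of_lt hs)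
      rw [e.deriv_eq]
      exact (((hasDerivAt_id' r).mul (ha.differentiable (by simp) r).hasDerivAt)).deriv.trans
        (by ring)
    rw [Real.norm_eq_abs, hd, hφ r hr.le]
    congr 1
    have h0 := hane r
    field_simp
    have := haβ r
    linear_combination (a r + 1) * this
  · refine le_trans (le_of_eq ?_) ((le_abs_self _).trans ((hM₂ r ⟨hr.le, hr1⟩).trans
      (le_max_right _ _)))
    have h0 := hane r
    rw [hφ r hr.le]
    field_simp

theorem exists_abs_lap_inPolar_le {φ : ℝ → ℝ} (h : IsSmoothProfile φ) {u : Plane → ℝ}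
    (hu : ContDiff ℝ 2 u) :
    ∃ M : ℝ, ∀ r, 0 < r → r ≤ 1 → ∀ θ, |lap φ (inPolar u) r θ| ≤ M := by
  obtain ⟨M, hM⟩ := h.exists_coeff_bound
  have hc1 : ContDiff ℝ 1 (fderiv ℝ u) := hu.fderiv_right (by norm_num)
  obtain ⟨M₁, hM₁⟩ := (isCompact_closedBall (0 : Plane) 1).exists_bound_of_continuousOn
    hc1.continuous.continuousOn
  obtain ⟨M₂, hM₂⟩ := (isCompact_closedBall (0 : Plane) 1).exists_bound_of_continuousOn
    (hc1.continuous_fderiv (by simp)).continuousOn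
  refine ⟨M₂ + M * M₁ + M * M₂, fun r hr hr1 θ => ?_⟩
  have hmem : polarPt r θ ∈ Metric.closedBall (0 : Plane) 1 := by
    rw [mem_closedBall_zero_iff, norm_polarPt, abs_of_pos hr]
    exact hr1
  obtain ⟨h1, h2⟩ := hM r hr hr1
  have hone : ∀ t, ‖polarPt 1 t‖ = 1 := fun t => by rw [norm_polarPt, abs_one]
  have b1 : ∀ t, |fderiv ℝ u (polarPt r θ) (polarPt 1 t)| ≤ M₁ := fun t => by
    refine ((fderiv ℝ u (polarPt r θ)).le_opNorm _).trans ?_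
    rw [hone, mul_one]
    exact hM₁ _ hmem
  have b2 : ∀ t, |fderiv ℝ (fderiv ℝ u) (polarPt r θ) (polarPt 1 t) (polarPt 1 t)| ≤ M₂ :=
    fun t => by
      refine ((fderiv ℝ (fderiv ℝ u) (polarPt r θ)).le_opNorm₂ _ _).trans ?_
      rw [hone, mul_one, mul_one]
      exact hM₂ _ hmem
  rw [lap_inPolar_eq h hu hr]
  refine (abs_add_three _ _ _).trans (add_le_add (add_le_add (b2 _) ?_) ?_)
  · rw [abs_mul]
    exact mul_le_mul h1 (b1 _) (abs_nonneg _) ((abs_nonneg _).trans h1)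
  · rw [abs_mul, abs_of_nonneg (sq_nonneg _)]
    exact mul_le_mul h2 (b2 _) (abs_nonneg _) ((sq_nonneg _).trans h2)

/-- The modes of `Δu` are multiples of `exp (|n| T)`, being bounded near the origin. Boundedness of the
modes of `u` makes these multiples vanish, and `Δu = 0` by completeness of the Fourier system. -/
theorem IsSmoothProfile.isHarmonic_of_isBiharmonic {φ : ℝ → ℝ} (h : IsSmoothProfile φ)
    (hmono : ∃ R : ℝ, MonotoneOn φ (Set.Ici R)) {η : ℝ}
    (hK : ∃ C : Set Plane, IsCompact C ∧ ∀ r θ : ℝ, 0 < r → polarPt r θ ∉ C →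
      -(η * r ^ 2) ≤ curv φ r θ)
    {u : Plane → ℝ} (hu : IsBiharmonic φ u) (hb : IsBoundedFun u) : IsHarmonic φ u := by
  obtain ⟨R, hR⟩ := hmono
  obtain ⟨C, hC, hK⟩ := hK
  obtain ⟨rC, hrC, hCout⟩ := exists_forall_polarPt_notMem hC
  obtain ⟨B, hB⟩ := hb
  obtain ⟨hu4, hu0⟩ := hu
  have hu2 : ContDiff ℝ 2 u := hu4.of_le (by norm_num)
  refine ⟨hu2, ?_⟩
  obtain ⟨T, hT, hT0⟩ := h.exists_conformal_coordinate
  obtain ⟨M, hM⟩ := exists_abs_lap_inPolar_le h hu2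
  set r₀ := max rC R with hr₀
  have hr₀C : rC ≤ r₀ := le_max_left _ _
  have hr₀R : R ≤ r₀ := le_max_right _ _
  have hr₀pos : 0 < r₀ := by linarith
  obtain ⟨A, hA⟩ := exists_deriv_le_mul_of_second_deriv_le (η := η) hr₀pos
    (fun r hr => h.pos r (by linarith))
    (fun r hr => h.hasDerivAt (by linarith)) (fun r hr => h.hasDerivAt_deriv (by linarith))
    (fun r hr => by
      have hr0 : 0 < r := by linarith
      have h1 := hK r 0 hr0 (hCout r 0 (by linarith))
      rwa [curv_eq h hr0, neg_div, neg_le_neg_iff, div_le_iff₀ (h.pos r hr0)] at h1)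
  have hU4 : ContDiffOn ℝ ((2 : ℕ) + 2) (Function.uncurry (inPolar u)) polarDomain := by
    have := contDiffOn_inPolar (n := 4) (by exact_mod_cast hu4)
    norm_num at this ⊢
    exact this
  have hL2 : ContDiffOn ℝ ((0 : ℕ) + 2) (Function.uncurry (lap φ (inPolar u))) polarDomain := by
    simpa using contDiffOn_lap h hU4
  have hLp : ∀ r, 0 < r → Function.Periodic (lap φ (inPolar u) r) (2 * Real.pi) :=
    fun r hr => lap_periodic h hU4 (inPolar_periodic u) hr
  intro r θ hr
  refine eq_zero_of_forall_integral_mul_cos_eq_zero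
    (continuous_of_contDiffOn (contDiffOn_lap h hU4) hr) (hLp r hr) (fun n α => ?_) θ
  set U := inPolar u with hU
  have hUm : ∀ r, |mode n α U r| ≤ B * (2 * Real.pi) := fun r =>
    abs_mode_le n α fun θ => hB (polarPt r θ)
  have hU1 : ContDiffOn ℝ ((3 : ℕ) + 1) (Function.uncurry U) polarDomain := by
    norm_num at hU4 ⊢
    exact hU4
  have hL1 : ContDiffOn ℝ ((1 : ℕ) + 1) (Function.uncurry (lap φ U)) polarDomain := by
    norm_num at hL2 ⊢
    exact hL2
  have hUr : ContDiffOn ℝ ((2 : ℕ) + 1) (Function.uncurry (pd1 U)) polarDomain := by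
    have := contDiffOn_pd1 hU1
    norm_num at this ⊢
    exact this
  have hLr : ContDiffOn ℝ ((0 : ℕ) + 1) (Function.uncurry (pd1 (lap φ U))) polarDomain := by
    simpa using contDiffOn_pd1 hL1
  obtain ⟨c, hc⟩ := exists_eq_mul_exp_of_bounded (κ := |(n : ℝ)|) (h := mode n α (lap φ U))
    (h' := mode n α (pd1 (lap φ U))) (abs_nonneg _) h.pos (fun r hr => h.hasDerivAt hr) hT hT0
    (fun r hr => hasDerivAt_mode n α hL1 hr)
    (fun r hr => (hasDerivAt_mode n α hLr hr).congr_deriv (by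
      have e1 := mode_lap h n α hL2 hr (hLp r hr)
      have e2 : mode n α (lap φ (lap φ U)) r = 0 := by simp [mode, hu0 r _ hr]
      rw [sq_abs]
      linarith))
    (fun r hr hr1 => abs_mode_le n α (hM r hr hr1))
  have hc0 : c = 0 := eq_zero_of_bounded_of_mode_equation (κ := |(n : ℝ)|) (u := mode n α U)
    (u' := mode n α (pd1 U)) (φ := φ) (T := T) (abs_nonneg _) (h.pos r₀ hr₀pos) hr₀pos
    (fun r hr => hR (Set.mem_Ici.2 hr₀R) (Set.mem_Ici.2 (hr₀R.trans hr)) hr)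
    (fun r hr => h.hasDerivAt (hr₀pos.trans_le hr)) hA (fun r hr => hT r (hr₀pos.trans_le hr))
    (fun r hr => hasDerivAt_mode n α hU1 (hr₀pos.trans_le hr))
    (fun r hr => (hasDerivAt_mode n α hUr (hr₀pos.trans_le hr)).congr_deriv (by
      have e1 := mode_lap h n α hU4 (hr₀pos.trans_le hr) (inPolar_periodic u r)
      rw [sq_abs, ← hc r (hr₀pos.trans_le hr)]
      linarith))
    (fun r _ => hUm r)
  have := hc r hr
  rwa [hc0, zero_mul] at this

end RotSurface

theorem theorem1p3 (φ : ℝ → ℝ) (hφ : RotSurface.IsSmoothProfile φ)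
    (hmono : ∃ R : ℝ, MonotoneOn φ (Set.Ici R)) :
    (∀ ε : ℝ, 0 < ε →
      (∃ C : Set RotSurface.Plane, IsCompact C ∧
        ∀ r θ : ℝ, 0 < r → RotSurface.polarPt r θ ∉ C →
          RotSurface.curv φ r θ ≤ -(r ^ (2 + ε))) →
      ∃ u : RotSurface.Plane → ℝ, RotSurface.IsBiharmonic φ u ∧ RotSurface.IsBoundedFun u ∧
        ¬ RotSurface.IsHarmonic φ u) ∧
    (∀ η ε : ℝ, 0 < η → 0 < ε →
      (∃ C : Set RotSurface.Plane, IsCompact C ∧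
        ∀ r θ : ℝ, 0 < r → RotSurface.polarPt r θ ∉ C →
          -(η * r ^ 2) ≤ RotSurface.curv φ r θ ∧
          RotSurface.curv φ r θ ≤ -((1 + ε) / (r ^ 2 * Real.log r))) →
      ∀ u : RotSurface.Plane → ℝ, RotSurface.IsBiharmonic φ u → RotSurface.IsBoundedFun u →
        RotSurface.IsHarmonic φ u) := by
  refine ⟨fun ε hε hK => hφ.exists_biharmonic hmono hε hK, fun η ε _ _ hK u hu hb => ?_⟩
  obtain ⟨C, hC, hK⟩ := hK
  exact hφ.isHarmonic_of_isBiharmonic hmono ⟨C, hC, fun r θ hr hout => (hK r θ hr hout).1⟩ hu hb
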